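/- Let $m\ge 1$ and $n\ge 0$ be integers and let $R=\mathbb{C}[q,q^{-1},v_1,\dots,v_m]$, where $q,v_1,\dots,v_m$ are indeterminates. Let $H(m,1,n)$ be the cyclotomic Hecke algebra, i.e. the associative unital $R$-algebra generated by $\tau,\sigma_1,\dots,\sigma_{n-1}$ (no generators if $n=0$, only $\tau$ if $n=1$) with the defining relations $$\sigma_i\sigma_{i+1}\sigma_i=\sigma_{i+1}\sigma_i\sigma_{i+1}\ (1\le i\le n-2),\qquad \sigma_i\sigma_j=\sigma_j\sigma_i\ (|i-j|>1),$$ $$\tau\sigma_1\tau\sigma_1=\sigma_1\tau\sigma_1\tau,\qquad \tau\sigma_i=\sigma_i\tau\ (i>1),$$ $$\sigma_i^2=(q-q^{-1})\sigma_i+1\ (1\le i\le n-1),\qquad (\tau-v_1)\cdots(\tau-v_m)=0.$$ Let $G(m,1,n)\subset GL_n(\mathbb{C})$ be the complex reflection group of all monomial $n\times n$ matrices whose nonzero entries are $m$-th roots of unity. Then: (i) $H(m,1,n)$ is a flat deformation of the group algebra $\mathbb{C}G(m,1,n)$: it is a free $R$-module of finite rank $|G(m,1,n)|=n!\,m^n$,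 and its specialization $\mathbb{C}\otimes_R H(m,1,n)$ along the ring homomorphism $R\to\mathbb{C}$ that is the identity on $\mathbb{C}$ and sends $q\mapsto 1$, $v_j\mapsto \zeta^{\,j-1}$ with $\zeta=e^{2\pi i/m}$, is isomorphic to $\mathbb{C}G(m,1,n)$ as a $\mathbb{C}$-algebra. (ii) If $n\ge 1$, the subalgebra $\tilde W$ of $H(m,1,n)$ generated by $\tau,\sigma_1,\dots,\sigma_{n-2}$ (for $n=1$: $\tilde W$ is the image of $R$) is isomorphic to $H(m,1,n-1)$, by an isomorphism of $R$-algebras $H(m,1,n-1)\to\tilde W$ that sends $\tau$ to $\tau$ (if $n\ge 2$) and $\sigma_i$ to $\sigma_i$ for $1\le i\le n-2$. -/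

import Mathlib

open scoped TensorProduct LaurentPolynomial

/-- The generators `τ, σ_1, …, σ_{n-1}` of `H(m,1,n)`. For `n = 0` there are none,
and for `n = 1` there is only `τ`. -/
inductive HeckeGen (n : ℕ) : Type
  | tau (h : 1 ≤ n) : HeckeGen n
  | sigma (i : ℕ) (h₁ : 1 ≤ i) (h₂ : i + 1 ≤ n) : HeckeGen n

namespace CyclotomicHecke

section Presentation

variable {A : Type} [CommRing A] {m : ℕ} (q : Aˣ) (v : Fin m → A) (n : ℕ)

/-- The letter `τ` of the free algebra. -/
def freeTau (h : 1 ≤ n) : FreeAlgebra A (HeckeGen n) :=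
  FreeAlgebra.ι A (HeckeGen.tau h)

/-- The letter `σ_i` of the free algebra, `1 ≤ i ≤ n - 1`. -/
def freeSigma (i : ℕ) (h₁ : 1 ≤ i) (h₂ : i + 1 ≤ n) : FreeAlgebra A (HeckeGen n) :=
  FreeAlgebra.ι A (HeckeGen.sigma i h₁ h₂)

/-- The defining relations of the cyclotomic Hecke algebra over `A` with parameters
`q` and `v_1, …, v_m`. -/
inductive Rel : FreeAlgebra A (HeckeGen n) → FreeAlgebra A (HeckeGen n) → Prop
  /-- `σ_i σ_{i+1} σ_i = σ_{i+1} σ_i σ_{i+1}` -/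
  | braid (i : ℕ) (h₁ : 1 ≤ i) (h₂ : i + 1 ≤ n) (h₃ : 1 ≤ i + 1) (h₄ : i + 1 + 1 ≤ n) :
      Rel
        (freeSigma n i h₁ h₂ * freeSigma n (i + 1) h₃ h₄ * freeSigma n i h₁ h₂)
        (freeSigma n (i + 1) h₃ h₄ * freeSigma n i h₁ h₂ * freeSigma n (i + 1) h₃ h₄)
  /-- `σ_i σ_j = σ_j σ_i` for `|i - j| > 1` -/
  | comm (i j : ℕ) (h₁ : 1 ≤ i) (h₂ : i + 1 ≤ n) (h₃ : 1 ≤ j) (h₄ : j + 1 ≤ n)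
      (hij : i + 1 < j ∨ j + 1 < i) :
      Rel
        (freeSigma n i h₁ h₂ * freeSigma n j h₃ h₄)
        (freeSigma n j h₃ h₄ * freeSigma n i h₁ h₂)
  /-- `τ σ_1 τ σ_1 = σ_1 τ σ_1 τ` -/
  | tau_braid (h : 1 ≤ n) (h₁ : 1 ≤ 1) (h₂ : 1 + 1 ≤ n) :
      Rel
        (freeTau n h * freeSigma n 1 h₁ h₂ * freeTau n h * freeSigma n 1 h₁ h₂)
        (freeSigma n 1 h₁ h₂ * freeTau n h * freeSigma n 1 h₁ h₂ * freeTau n h)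
  /-- `τ σ_i = σ_i τ` for `i > 1` -/
  | tau_comm (h : 1 ≤ n) (i : ℕ) (h₁ : 1 ≤ i) (h₂ : i + 1 ≤ n) (hi : 1 < i) :
      Rel
        (freeTau n h * freeSigma n i h₁ h₂)
        (freeSigma n i h₁ h₂ * freeTau n h)
  /-- `σ_i² = (q - q⁻¹) σ_i + 1` -/
  | quadratic (i : ℕ) (h₁ : 1 ≤ i) (h₂ : i + 1 ≤ n) :
      Rel
        (freeSigma n i h₁ h₂ ^ 2)
        (((q : A) - ((q⁻¹ : Aˣ) : A)) • freeSigma n i h₁ h₂ + 1)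
  /-- `(τ - v_1) ⋯ (τ - v_m) = 0` -/
  | cyclotomic (h : 1 ≤ n) :
      Rel
        (List.ofFn fun j : Fin m => freeTau n h - algebraMap A _ (v j)).prod
        0

end Presentation

end CyclotomicHecke

/-- The cyclotomic Hecke algebra `H(m,1,n)` over a commutative ring `A` with parameters `q`
(invertible) and `v_1, …, v_m`: the associative unital `A`-algebra generated by
`τ, σ_1, …, σ_{n-1}` with the defining relations above. -/
def CyclotomicHecke {A : Type} [CommRing A] {m : ℕ} (q : Aˣ) (v : Fin m → A) (n : ℕ) : Type :=
  RingQuot (CyclotomicHecke.Rel q v n)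

namespace CyclotomicHecke

section Instances

variable {A : Type} [CommRing A] {m : ℕ} (q : Aˣ) (v : Fin m → A) (n : ℕ)

instance : Ring (CyclotomicHecke q v n) :=
  inferInstanceAs (Ring (RingQuot (CyclotomicHecke.Rel q v n)))

instance : Algebra A (CyclotomicHecke q v n) :=
  inferInstanceAs (Algebra A (RingQuot (CyclotomicHecke.Rel q v n)))

/-- The generator `τ`. -/
def tau (h : 1 ≤ n) : CyclotomicHecke q v n :=
  RingQuot.mkAlgHom A (CyclotomicHecke.Rel q v n) (freeTau n h)

/-- The generator `σ_i`, `1 ≤ i ≤ n - 1`. -/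
def sigma (i : ℕ) (h₁ : 1 ≤ i) (h₂ : i + 1 ≤ n) : CyclotomicHecke q v n :=
  RingQuot.mkAlgHom A (CyclotomicHecke.Rel q v n) (freeSigma n i h₁ h₂)

/-- The subalgebra `W̃` generated by the first `n - 1` of the generators
`τ, σ_1, …, σ_{n-1}`: by `τ, σ_1, …, σ_{n-2}` if `n ≥ 2`, and by nothing if `n ≤ 1`. -/
def subW : Subalgebra A (CyclotomicHecke q v n) :=
  Algebra.adjoin A
    {x | (∃ h : 2 ≤ n, x = tau q v n (by omega)) ∨
      ∃ (i : ℕ) (h₁ : 1 ≤ i) (h₂ : i + 2 ≤ n), x = sigma q v n i h₁ (by omega)}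

end Instances

/-! ### The generic algebra -/

/-- The ring `ℂ[q, q⁻¹, v_1, …, v_m]`. -/
abbrev GenericRing (m : ℕ) : Type := MvPolynomial (Fin m) ℂ[T;T⁻¹]

/-- The indeterminate `q`, as a unit of `ℂ[q, q⁻¹, v_1, …, v_m]`. -/
noncomputable def genericQ (m : ℕ) : (GenericRing m)ˣ :=
  Units.map (MvPolynomial.C : ℂ[T;T⁻¹] →+* GenericRing m).toMonoidHom
    ⟨LaurentPolynomial.T 1, LaurentPolynomial.T (-1),
      by rw [← LaurentPolynomial.T_add]; simp,
      by rw [← LaurentPolynomial.T_add]; simp⟩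

/-- The generic algebra `H(m,1,n)` over `ℂ[q, q⁻¹, v_1, …, v_m]`. -/
abbrev Generic (m n : ℕ) : Type :=
  CyclotomicHecke (genericQ m) (MvPolynomial.X : Fin m → GenericRing m) n

/-- The specialization `ℂ[q, q⁻¹, v_1, …, v_m] → ℂ` with `q ↦ 1` and
`v_1, …, v_m ↦ 1, ζ, …, ζ^{m-1}`, where `ζ = exp(2πi/m)`. -/
noncomputable def specialization (m : ℕ) : GenericRing m →+* ℂ :=
  MvPolynomial.eval₂Hom (LaurentPolynomial.eval₂ (RingHom.id ℂ) (1 : ℂˣ))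
    fun j : Fin m => Complex.exp (2 * Real.pi * Complex.I / m) ^ (j : ℕ)

/-- `ℂ` as an algebra over `ℂ[q, q⁻¹, v_1, …, v_m]` through `specialization m`. -/
noncomputable abbrev specializationAlgebra (m : ℕ) : Algebra (GenericRing m) ℂ :=
  (specialization m).toAlgebra

end CyclotomicHecke

/-- The complex reflection group `G(m,1,n)`: the monomial `n × n` matrices whose nonzero entries
are `m`-th roots of unity. -/
def reflectionGroup (m n : ℕ) : Subgroup (GL (Fin n) ℂ) where
  carrier := {g | ∃ (z : Fin n → rootsOfUnity m ℂ) (π : Equiv.Perm (Fin n)),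
    ∀ i j, (g : Matrix (Fin n) (Fin n) ℂ) i j = if i = π j then ((z i : ℂˣ) : ℂ) else 0}
  one_mem' := ⟨1, 1, fun i j => by
    by_cases h : i = j <;> simp [h]⟩
  mul_mem' := by
    rintro g h ⟨z, π, hg⟩ ⟨w, ρ, hh⟩
    refine ⟨fun i => z i * w (π⁻¹ i), π * ρ, fun i j => ?_⟩
    rw [Units.val_mul, Matrix.mul_apply, Finset.sum_eq_single (ρ j)]
    · rw [hg, hh]
      by_cases hi : i = π (ρ j)
      · subst hi; simp
      · simp [hi]
    · intro k _ hk
      simp [hh, hk]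
    · simp
  inv_mem' := by
    rintro g ⟨z, π, hg⟩
    let B : Matrix (Fin n) (Fin n) ℂ := fun i j =>
      if i = π⁻¹ j then (((z (π i))⁻¹ : rootsOfUnity m ℂ) : ℂˣ) else 0
    have hB : (g : Matrix (Fin n) (Fin n) ℂ) * B = 1 := by
      ext i j
      rw [Matrix.mul_apply, Finset.sum_eq_single (π⁻¹ j)]
      · rw [hg]
        by_cases hi : i = j
        · subst hi; simp [B]
        · simp [hi]
      · intro k _ hk
        rw [show B k j = 0 from if_neg hk, mul_zero]
      · simp
    have hinv : ((g⁻¹ : GL (Fin n) ℂ) : Matrix (Fin n) (Fin n) ℂ) = B :=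
      Units.inv_eq_of_mul_eq_one_right hB
    exact ⟨fun i => (z (π i))⁻¹, π⁻¹, fun i j => by rw [hinv]⟩

/-! The rank is bounded above by a spanning set and below by a representation.

Upper bound. Put X_k = s_k ⋯ s_1 t s_1 ⋯ s_k. This element commutes with the algebra of level k,
generated by t, s_1, …, s_{k-1}. The elements w X_k^a s_k ⋯ s_{k-j+1}, with w of level k, a < m and
j ≤ k, span the algebra of level k + 1, because their span contains 1 and is stable under right
multiplication by the generators (`parabolic_le_cosetSpan`). The hard case is the reduction of X_k^m
(`jucysMurphy_pow_mem`). Iteration over k leaves n! m^n standard monomials.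

Lower bound. The algebra acts on the free module on words with distinct coloured letters. There σ_i
acts by the usual Hecke operator T_i for an order of the letters in which the colour is monotone.
Let S_i agree with T_i on letters of equal colour and merely exchange letters of different colours,
and let ϖ multiply by the parameter of the first letter's colour. Then τ acts by T_1⁻¹ ⋯ T_k⁻¹ S_k ⋯
S_1 ϖ with k = n - 1. The braid relations reduce to Yang–Baxter identities among T and S, and the
cyclotomic relation holds because τ is triangular for the colour of the first letter
(`heckeSystem_wordOps`).

Independence is tested at a point where q - q⁻¹ vanishes and the v_j are distinct. There σ_i only
permutes and τ = ϖ, and the sum of all colourings of the identity word generates all n! m^n coloured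
permutations (`wordVec_permWord_mem`). The square matrix of the monomials applied to this vector
therefore has nonzero determinant at that point, hence over the domain itself
(`linearIndependent_of_wordOps`).

Consequences. The monomials of level n - 1 are among those of level n, so the natural map between
the algebras is injective. The specialized algebra surjects onto the group algebra, and the two have
equal dimension. -/

namespace CyclotomicHecke

/-! ### Jucys–Murphy elements and the spanning set of standard monomials -/

section Spanning

variable {R : Type*} {H : Type*} [CommRing R] [Ring H] [Algebra R H]

/-- Elements `t` and `s 1, …, s (n - 1)` of an algebra that satisfy the defining relations of the
cyclotomic Hecke algebra, where `c` stands for `q - q⁻¹`. -/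
structure HeckeSystem (c : R) {m : ℕ} (v : Fin m → R) (n : ℕ) (t : H) (s : ℕ → H) : Prop where
  braid : ∀ i, 1 ≤ i → i + 2 ≤ n → s i * s (i + 1) * s i = s (i + 1) * s i * s (i + 1)
  comm : ∀ i j, 1 ≤ i → i + 1 < j → j + 1 ≤ n → Commute (s i) (s j)
  tau_braid : 2 ≤ n → t * s 1 * t * s 1 = s 1 * t * s 1 * t
  tau_comm : ∀ i, 2 ≤ i → i + 1 ≤ n → Commute t (s i)
  quadratic : ∀ i, 1 ≤ i → i + 1 ≤ n → s i * s i = c • s i + 1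
  cyclotomic : 1 ≤ n → (List.ofFn fun j : Fin m => t - algebraMap R H (v j)).prod = 0

/-- The Jucys–Murphy elements: `jucysMurphy t s k` is `s_k ⋯ s_1 t s_1 ⋯ s_k`. -/
def jucysMurphy (t : H) (s : ℕ → H) : ℕ → H
  | 0 => t
  | k + 1 => s (k + 1) * jucysMurphy t s k * s (k + 1)

/-- The product `s_k s_{k-1} ⋯ s_{k-j+1}` of `j` factors. -/
def descending (s : ℕ → H) (k : ℕ) : ℕ → H
  | 0 => 1
  | j + 1 => descending s k j * s (k - j)

variable (R) in
/-- The subalgebra generated by `t, s_1, …, s_{k-1}`. -/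
def parabolic (t : H) (s : ℕ → H) (k : ℕ) : Subalgebra R H :=
  Algebra.adjoin R {x | (1 ≤ k ∧ x = t) ∨ ∃ i, 1 ≤ i ∧ i + 1 ≤ k ∧ x = s i}

variable (R) in
/-- The span of the elements `w X^a s_k ⋯ s_{k-j+1}` with `w` in the parabolic subalgebra of
level `k`, `X` the next Jucys–Murphy element, and `a < M`. -/
def cosetSpan (t : H) (s : ℕ → H) (k M : ℕ) : Submodule R H :=
  Submodule.span R {x | ∃ w ∈ parabolic R t s k, ∃ a < M, ∃ j ≤ k,
    x = w * jucysMurphy t s k ^ a * descending s k j}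

lemma t_mem_parabolic (t : H) (s : ℕ → H) {k : ℕ} (hk : 1 ≤ k) : t ∈ parabolic R t s k :=
  Algebra.subset_adjoin (Or.inl ⟨hk, rfl⟩)

lemma s_mem_parabolic (t : H) (s : ℕ → H) {k i : ℕ} (hi : 1 ≤ i) (hk : i + 1 ≤ k) :
    s i ∈ parabolic R t s k :=
  Algebra.subset_adjoin (Or.inr ⟨i, hi, hk, rfl⟩)

lemma parabolic_mono (t : H) (s : ℕ → H) {k l : ℕ} (h : k ≤ l) :
    parabolic R t s k ≤ parabolic R t s l := by
  apply Algebra.adjoin_mono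
  rintro x (⟨h1, rfl⟩ | ⟨i, h1, h2, rfl⟩)
  · exact Or.inl ⟨h1.trans h, rfl⟩
  · exact Or.inr ⟨i, h1, h2.trans h, rfl⟩

lemma jucysMurphy_mem_parabolic (t : H) (s : ℕ → H) (k : ℕ) :
    jucysMurphy t s k ∈ parabolic R t s (k + 1) := by
  induction k with
  | zero => exact t_mem_parabolic t s le_rfl
  | succ k ih =>
    have h := parabolic_mono (R := R) t s (Nat.le_succ (k + 1)) ih
    have hs : s (k + 1) ∈ parabolic R t s (k + 2) := s_mem_parabolic t s (by omega) (by omega)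
    exact mul_mem (mul_mem hs h) hs

lemma mul_mem_cosetSpan {t : H} {s : ℕ → H} {k M : ℕ} {w x : H} (hw : w ∈ parabolic R t s k)
    (hx : x ∈ cosetSpan R t s k M) : w * x ∈ cosetSpan R t s k M := by
  induction hx using Submodule.span_induction with
  | mem x hx =>
    obtain ⟨w', hw', a, ha, j, hj, rfl⟩ := hx
    exact Submodule.subset_span ⟨w * w', mul_mem hw hw', a, ha, j, hj, by simp only [mul_assoc]⟩
  | zero => simp
  | add x y _ _ hx hy => rw [mul_add]; exact add_mem hx hy
  | smul r x _ hx => rw [mul_smul_comm]; exact Submodule.smul_mem _ _ hx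

lemma mul_jucysMurphy_pow_mem_cosetSpan {t : H} {s : ℕ → H} {k M a : ℕ} {w : H}
    (hw : w ∈ parabolic R t s k) (ha : a < M) :
    w * jucysMurphy t s k ^ a ∈ cosetSpan R t s k M :=
  Submodule.subset_span ⟨w, hw, a, ha, 0, Nat.zero_le _, by simp [descending]⟩

namespace HeckeSystem

variable {c : R} {m : ℕ} {v : Fin m → R} {n : ℕ} {t : H} {s : ℕ → H}

lemma commute_s (h : HeckeSystem c v n t s) {i j : ℕ} (hi : 1 ≤ i) (hin : i + 1 ≤ n) (hj : 1 ≤ j)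
    (hjn : j + 1 ≤ n) (hij : i + 1 < j ∨ j + 1 < i) : Commute (s i) (s j) := by
  rcases hij with hij | hij
  · exact h.comm i j hi hij hjn
  · exact (h.comm j i hj hij hin).symm

lemma commute_jucysMurphy_of_lt (h : HeckeSystem c v n t s) {k i : ℕ} (hki : k + 2 ≤ i)
    (hin : i + 1 ≤ n) : Commute (jucysMurphy t s k) (s i) := by
  induction k with
  | zero => exact h.tau_comm i hki hin
  | succ k ih =>
    have hc : Commute (s (k + 1)) (s i) := h.comm _ _ (by omega) (by omega) hin
    exact (hc.mul_left (ih (by omega))).mul_left hc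

/-- The outer factors of X_k commute with s_i unless i = k - 1. In that case X_k = b a x a b with a
= s_{k-1}, b = s_k and x commuting with b, and the braid relation, applied once on each side of x,
carries a through. -/
lemma commute_jucysMurphy_s (h : HeckeSystem c v n t s) {k i : ℕ} (hi : 1 ≤ i) (hik : i + 1 ≤ k)
    (hkn : k + 1 ≤ n) : Commute (jucysMurphy t s k) (s i) := by
  induction k with
  | zero => omega
  | succ k ih =>
    rcases Nat.lt_or_ge i k with hik' | hik'
    · have hc : Commute (s (k + 1)) (s i) := (h.comm _ _ hi (by omega) hkn).symm
      exact (hc.mul_left (ih (by omega) (by omega))).mul_left hc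
    · obtain rfl : i = k := by omega
      obtain ⟨i, rfl⟩ : ∃ j, i = j + 1 := ⟨i - 1, by omega⟩
      have hb := h.braid (i + 1) (by omega) (by omega)
      have hX : jucysMurphy t s i * s (i + 1 + 1) = s (i + 1 + 1) * jucysMurphy t s i :=
        h.commute_jucysMurphy_of_lt (by omega) (by omega)
      change s (i + 1 + 1) * (s (i + 1) * jucysMurphy t s i * s (i + 1)) * s (i + 1 + 1) * s (i + 1)
        = s (i + 1) * (s (i + 1 + 1) * (s (i + 1) * jucysMurphy t s i * s (i + 1)) * s (i + 1 + 1))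
      generalize s (i + 1) = a at *
      generalize s (i + 1 + 1) = b at *
      generalize jucysMurphy t s i = x at *
      calc b * (a * x * a) * b * a = b * a * x * (a * b * a) := by simp only [mul_assoc]
        _ = b * a * (x * b) * a * b := by rw [hb]; simp only [mul_assoc]
        _ = (b * a * b) * x * a * b := by rw [hX]; simp only [mul_assoc]
        _ = a * (b * (a * x * a) * b) := by rw [← hb]; simp only [mul_assoc]

lemma commute_jucysMurphy_t (h : HeckeSystem c v n t s) {k : ℕ} (hkn : k + 1 ≤ n) :
    Commute (jucysMurphy t s k) t := by
  induction k with
  | zero => exact Commute.refl _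
  | succ k ih =>
    rcases Nat.eq_zero_or_pos k with rfl | hk
    · have := h.tau_braid hkn
      change s 1 * t * s 1 * t = t * (s 1 * t * s 1)
      rw [← this]; simp only [mul_assoc]
    · have hc : Commute (s (k + 1)) t := (h.tau_comm _ (by omega) hkn).symm
      exact (hc.mul_left (ih (by omega))).mul_left hc

lemma commute_jucysMurphy (h : HeckeSystem c v n t s) {k : ℕ} (hkn : k + 1 ≤ n) {w : H}
    (hw : w ∈ parabolic R t s k) : Commute (jucysMurphy t s k) w := by
  induction hw using Algebra.adjoin_induction with
  | mem x hx =>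
    rcases hx with ⟨_, rfl⟩ | ⟨i, h1, h2, rfl⟩
    · exact h.commute_jucysMurphy_t hkn
    · exact h.commute_jucysMurphy_s h1 h2 hkn
  | algebraMap r => exact (Algebra.commutes r _).symm
  | add x y _ _ hx hy => exact hx.add_right hy
  | mul x y _ _ hx hy => exact hx.mul_right hy

lemma commute_s_parabolic (h : HeckeSystem c v n t s) {k : ℕ} (hkn : k + 2 ≤ n) {w : H}
    (hw : w ∈ parabolic R t s k) : Commute (s (k + 1)) w := by
  induction hw using Algebra.adjoin_induction with
  | mem x hx =>
    rcases hx with ⟨_, rfl⟩ | ⟨i, h1, h2, rfl⟩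
    · exact (h.tau_comm _ (by omega) (by omega)).symm
    · exact (h.comm _ _ h1 (by omega) (by omega)).symm
  | algebraMap r => exact (Algebra.commutes r _).symm
  | add x y _ _ hx hy => exact hx.add_right hy
  | mul x y _ _ hx hy => exact hx.mul_right hy

lemma commute_descending (s : ℕ → H) {k j : ℕ} {x : H}
    (hx : ∀ i, k - j < i → i ≤ k → Commute x (s i)) (hj : j ≤ k) :
    Commute x (descending s k j) := by
  induction j with
  | zero => exact Commute.one_right _
  | succ j ih =>
    exact (ih (fun i h1 h2 => hx i (by omega) h2) (by omega)).mul_right (hx _ (by omega) (by omega))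

/-- The factors of the run to the right of s_i s_{i-1} commute with s_i. The braid relation turns
s_i s_{i-1} s_i into s_{i-1} s_i s_{i-1}, and the left s_{i-1} commutes with the factors before it.
-/
lemma descending_mul_s (h : HeckeSystem c v n t s) {k j i : ℕ} (hkn : k + 1 ≤ n) (hj : j ≤ k)
    (hi : k - j + 1 < i) (hik : i ≤ k) :
    descending s k j * s i = s (i - 1) * descending s k j := by
  induction j using Nat.strong_induction_on with
  | _ j ih =>
    obtain ⟨j, rfl⟩ : ∃ l, j = l + 1 := ⟨j - 1, by omega⟩
    rcases Nat.lt_or_ge (k - j + 1) i with hlt | hge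
    · have hc : s (k - j) * s i = s i * s (k - j) :=
        h.comm _ _ (by omega) (by omega) (by omega)
      calc descending s k j * s (k - j) * s i = descending s k j * s i * s (k - j) := by
            rw [mul_assoc, hc, mul_assoc]
        _ = _ := by rw [ih j (by omega) (by omega) hlt, mul_assoc]; rfl
    · obtain ⟨j, rfl⟩ : ∃ l, j = l + 1 := ⟨j - 1, by omega⟩
      obtain ⟨e, he⟩ : ∃ e, k - (j + 1) = e := ⟨_, rfl⟩
      have he' : k - j = e + 1 := by omega
      obtain rfl : i = e + 1 := by omega
      have hb := h.braid e (by omega) (by omega)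
      have hc : s e * descending s k j = descending s k j * s e :=
        commute_descending s (fun i h1 h2 => h.comm _ _ (by omega) (by omega) (by omega)) (by omega)
      change descending s k j * s (k - j) * s (k - (j + 1)) * s (e + 1) =
        s (e + 1 - 1) * (descending s k j * s (k - j) * s (k - (j + 1)))
      rw [he, he', Nat.add_sub_cancel]
      calc descending s k j * s (e + 1) * s e * s (e + 1)
          = descending s k j * (s (e + 1) * s e * s (e + 1)) := by simp only [mul_assoc]
        _ = descending s k j * s e * s (e + 1) * s e := by rw [← hb]; simp only [mul_assoc]
        _ = _ := by rw [← hc]; simp only [mul_assoc]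

/-- The coset span is closed under right multiplication by the generators `s i`. -/
lemma cosetSpan_mul_s (h : HeckeSystem c v n t s) {k M i : ℕ} (hkn : k + 1 ≤ n) (hi : 1 ≤ i)
    (hik : i ≤ k) {x : H} (hx : x ∈ cosetSpan R t s k M) : x * s i ∈ cosetSpan R t s k M := by
  induction hx using Submodule.span_induction with
  | mem x hx =>
    obtain ⟨w, hw, a, ha, j, hj, rfl⟩ := hx
    have move : ∀ i', 1 ≤ i' → i' + 1 ≤ k → descending s k j * s i = s i' * descending s k j →
        w * jucysMurphy t s k ^ a * descending s k j * s i ∈ cosetSpan R t s k M := by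
      intro i' h1 h2 h3
      have hs : s i' ∈ parabolic R t s k := s_mem_parabolic t s h1 h2
      refine Submodule.subset_span ⟨w * s i', mul_mem hw hs, a, ha, j, hj, ?_⟩
      have hc : jucysMurphy t s k ^ a * s i' = s i' * jucysMurphy t s k ^ a :=
        (h.commute_jucysMurphy hkn hs).pow_left a
      rw [mul_assoc, h3, ← mul_assoc, mul_assoc w, hc, ← mul_assoc]
    -- The run ends in s_{k-j+1}. For i < k - j the factor s_i passes through it, for i = k - j it
    -- lengthens the run, for i = k - j + 1 the quadratic relation applies, and for larger i it
    -- passes as s_{i-1}. A factor that passes lies in the algebra of level k and so also crosses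
    -- X_k.
    rcases lt_trichotomy i (k - j) with h1 | h1 | h1
    · refine move i hi (by omega) ?_
      exact (commute_descending s (fun i' h3 h4 => h.comm _ _ (by omega) (by omega) (by omega))
        hj).symm
    · subst h1
      exact Submodule.subset_span ⟨w, hw, a, ha, j + 1, by omega, by rw [mul_assoc]; rfl⟩
    · rcases Nat.lt_or_ge (k - j + 1) i with h2 | h2
      · exact move (i - 1) (by omega) (by omega) (h.descending_mul_s hkn hj h2 hik)
      · obtain ⟨j, rfl⟩ : ∃ l, j = l + 1 := ⟨j - 1, by omega⟩
        obtain rfl : i = k - j := by omega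
        have : w * jucysMurphy t s k ^ a * descending s k (j + 1) * s (k - j) =
            c • (w * jucysMurphy t s k ^ a * descending s k (j + 1)) +
              w * jucysMurphy t s k ^ a * descending s k j := by
          rw [mul_assoc, show descending s k (j + 1) * s (k - j) =
            descending s k j * (s (k - j) * s (k - j)) from mul_assoc _ _ _,
            h.quadratic _ hi (by omega), mul_add, mul_one, mul_smul_comm, mul_add, mul_smul_comm]
          rfl
        rw [this]
        exact add_mem (Submodule.smul_mem _ _ (Submodule.subset_span ⟨w, hw, a, ha, _, hj, rfl⟩))
          (Submodule.subset_span ⟨w, hw, a, ha, j, by omega, rfl⟩)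
  | zero => simp
  | add x y _ _ hx hy => rw [add_mul]; exact add_mem hx hy
  | smul r x _ hx => rw [smul_mul_assoc]; exact Submodule.smul_mem _ _ hx

lemma cosetSpan_mul_descending (h : HeckeSystem c v n t s) {k M l j : ℕ} (hkn : k + 1 ≤ n)
    (hl : l ≤ k) (hj : j ≤ l) {x : H} (hx : x ∈ cosetSpan R t s k M) :
    x * descending s l j ∈ cosetSpan R t s k M := by
  induction j with
  | zero => simpa [descending] using hx
  | succ j ih =>
    change x * (descending s l j * s (l - j)) ∈ _
    rw [← mul_assoc]
    exact h.cosetSpan_mul_s hkn (by omega) (by omega) (ih (by omega))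

/-- With X = X_k, Y = X_{k+1} and s = s_{k+1}, the relation Y = s X s gives s X = Y s⁻¹ = Y (s - c).
This is iterated, using that X and Y commute. -/
lemma s_mul_jucysMurphy_pow (h : HeckeSystem c v n t s) {k : ℕ} (hkn : k + 2 ≤ n) (a : ℕ) :
    s (k + 1) * jucysMurphy t s k ^ a = jucysMurphy t s (k + 1) ^ a * s (k + 1) -
      c • ∑ i ∈ Finset.range a, jucysMurphy t s k ^ i * jucysMurphy t s (k + 1) ^ (a - i) := by
  have hq := h.quadratic (k + 1) (by omega) (by omega)
  have hYX : Commute (jucysMurphy t s (k + 1)) (jucysMurphy t s k) :=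
    h.commute_jucysMurphy (by omega) (jucysMurphy_mem_parabolic (R := R) t s k)
  have hsX : s (k + 1) * jucysMurphy t s k =
      jucysMurphy t s (k + 1) * s (k + 1) - c • jucysMurphy t s (k + 1) := by
    simp only [jucysMurphy]
    rw [mul_assoc _ (s (k + 1)) (s (k + 1)), hq, mul_add, mul_smul_comm, mul_one]
    abel
  generalize jucysMurphy t s (k + 1) = Y at *
  generalize jucysMurphy t s k = X at *
  generalize s (k + 1) = σ at *
  induction a with
  | zero => simp
  | succ a ih =>
    rw [pow_succ, ← mul_assoc, ih, sub_mul, mul_assoc, hsX, Finset.sum_range_succ', mul_sub,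
      ← mul_assoc, ← pow_succ, mul_smul_comm, ← pow_succ, smul_mul_assoc, Finset.sum_mul, smul_add]
    have : ∀ i ∈ Finset.range a, X ^ i * Y ^ (a - i) * X = X ^ (i + 1) * Y ^ (a + 1 - (i + 1)) := by
      intro i _
      rw [mul_assoc, (hYX.pow_left _).eq, ← mul_assoc, ← pow_succ, Nat.add_sub_add_right]
    rw [Finset.sum_congr rfl this]
    simp only [pow_zero, one_mul, Nat.sub_zero]
    abel

/-- The previous identity with a = m is multiplied by s_{k+1} on the right. The term c Y^m s from
Y^m s² cancels the summand i = 0, so only powers of Y = X_{k+1} below m remain on the right-hand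
side. -/
lemma jucysMurphy_pow_eq (h : HeckeSystem c v n t s) {k : ℕ} (hkn : k + 2 ≤ n) (hm : 1 ≤ m) :
    jucysMurphy t s (k + 1) ^ m = s (k + 1) * jucysMurphy t s k ^ m * s (k + 1) +
      c • ∑ i ∈ Finset.range (m - 1), jucysMurphy t s k ^ (i + 1) *
        jucysMurphy t s (k + 1) ^ (m - (i + 1)) * s (k + 1) := by
  obtain ⟨m, rfl⟩ : ∃ l, m = l + 1 := ⟨m - 1, by omega⟩
  have hq := h.quadratic (k + 1) (by omega) (by omega)
  rw [h.s_mul_jucysMurphy_pow hkn, sub_mul, mul_assoc, hq, Finset.sum_range_succ']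
  simp only [mul_add, mul_smul_comm, mul_one, smul_mul_assoc, add_mul, Finset.sum_mul,
    smul_add, pow_zero, one_mul, Nat.sub_zero, Nat.add_sub_cancel]
  abel

lemma pow_mem_span_of_cyclotomic (h : HeckeSystem c v n t s) (hn : 1 ≤ n) :
    t ^ m ∈ Submodule.span R {x | ∃ a < m, x = t ^ a} := by
  -- The product is monic of degree m in t. The claim is stated for all m and v so that the first
  -- factor can be split off.
  have key : ∀ (m : ℕ) (v : Fin m → R),
      (List.ofFn fun j : Fin m => t - algebraMap R H (v j)).prod - t ^ m ∈
        Submodule.span R {x | ∃ a < m, x = t ^ a} := by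
    intro m
    induction m with
    | zero => intro v; simp
    | succ m ih =>
      intro v
      rw [List.ofFn_succ, List.prod_cons]
      have h1 := ih fun j => v j.succ
      set p := (List.ofFn fun j : Fin m => t - algebraMap R H (v j.succ)).prod
      have h2 : ∀ x ∈ Submodule.span R {x | ∃ a < m, x = t ^ a},
          t * x ∈ Submodule.span R {x | ∃ a < m + 1, x = t ^ a} := by
        intro x hx
        induction hx using Submodule.span_induction with
        | mem x hx =>
          obtain ⟨a, ha, rfl⟩ := hx
          exact Submodule.subset_span ⟨a + 1, by omega, (pow_succ' t a).symm⟩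
        | zero => simp
        | add x y _ _ hx hy => rw [mul_add]; exact add_mem hx hy
        | smul r x _ hx => rw [mul_smul_comm]; exact Submodule.smul_mem _ _ hx
      have h3 : p ∈ Submodule.span R {x | ∃ a < m + 1, x = t ^ a} := by
        rw [← sub_add_cancel p (t ^ m)]
        refine add_mem (Submodule.span_mono ?_ h1) (Submodule.subset_span ⟨m, by omega, rfl⟩)
        rintro x ⟨a, ha, rfl⟩
        exact ⟨a, by omega, rfl⟩
      have : (t - algebraMap R H (v 0)) * p - t ^ (m + 1) = t * (p - t ^ m) - v 0 • p := by
        rw [sub_mul, mul_sub, pow_succ', Algebra.smul_def]; abel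
      rw [this]
      exact sub_mem (h2 _ h1) (Submodule.smul_mem _ _ h3)
  have := key m v
  rw [h.cyclotomic hn, zero_sub] at this
  exact (Submodule.neg_mem_iff _).1 this

/-- The Jucys–Murphy elements satisfy monic relations of degree `m` modulo lower coset spans. -/
lemma jucysMurphy_pow_mem (h : HeckeSystem c v n t s) (hm : 1 ≤ m) {k : ℕ} (hkn : k + 1 ≤ n) :
    jucysMurphy t s k ^ m ∈ cosetSpan R t s k m := by
  induction k with
  | zero =>
    refine Submodule.span_mono ?_ (h.pow_mem_span_of_cyclotomic hkn)
    rintro x ⟨a, ha, rfl⟩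
    exact ⟨1, one_mem _, a, ha, 0, le_rfl, by simp [descending, jucysMurphy]⟩
  | succ k ih =>
    -- The sum involves only powers of X_{k+1} below m. In the term s_{k+1} X_k^m s_{k+1}, X_k^m is
    -- expanded by induction into elements w X_k^a s_k ⋯ with a < m. Here s_{k+1} commutes with w,
    -- and crossing X_k^a produces powers of X_{k+1} of exponent at most a.
    rw [h.jucysMurphy_pow_eq hkn hm]
    refine add_mem ?_ (Submodule.smul_mem _ _ (Submodule.sum_mem _ fun i hi => ?_))
    · have hX := ih (by omega)
      generalize jucysMurphy t s k ^ m = x at hX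
      induction hX using Submodule.span_induction with
      | mem x hx =>
        obtain ⟨w, hw, a, ha, j, hj, rfl⟩ := hx
        have hsw : s (k + 1) * w = w * s (k + 1) := h.commute_s_parabolic (by omega) hw
        have : s (k + 1) * (w * jucysMurphy t s k ^ a * descending s k j) * s (k + 1) =
            w * (s (k + 1) * jucysMurphy t s k ^ a * descending s k j * s (k + 1)) := by
          rw [← mul_assoc, ← mul_assoc, hsw]; simp only [mul_assoc]
        rw [this]
        refine mul_mem_cosetSpan (parabolic_mono (R := R) t s (Nat.le_succ k) hw) ?_
        refine h.cosetSpan_mul_s hkn (by omega) le_rfl ?_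
        refine h.cosetSpan_mul_descending hkn (by omega) hj ?_
        rw [h.s_mul_jucysMurphy_pow hkn]
        refine sub_mem ?_ (Submodule.smul_mem _ _ (Submodule.sum_mem _ fun i _ => ?_))
        · refine h.cosetSpan_mul_s hkn (by omega) le_rfl ?_
          simpa using mul_jucysMurphy_pow_mem_cosetSpan (one_mem (parabolic R t s (k + 1))) ha
        · exact mul_jucysMurphy_pow_mem_cosetSpan
            (pow_mem (jucysMurphy_mem_parabolic t s k) i) (by omega)
      | zero => simp
      | add x y _ _ hx hy => rw [mul_add, add_mul]; exact add_mem hx hy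
      | smul r x _ hx =>
        rw [mul_smul_comm, smul_mul_assoc]; exact Submodule.smul_mem _ _ hx
    · exact h.cosetSpan_mul_s hkn (by omega) le_rfl (mul_jucysMurphy_pow_mem_cosetSpan
        (pow_mem (jucysMurphy_mem_parabolic t s k) _) (by omega))

/-- This rests on s_l ⋯ s_1 t = X_l s_l⁻¹ ⋯ s_1⁻¹: the coset span is stable under right
multiplication by s_i⁻¹ = s_i - c. The induction peels off one factor at a time. -/
lemma cosetSpan_mul_mul_t (h : HeckeSystem c v n t s) {k l M : ℕ} (hkn : k + 1 ≤ n) (hl : l ≤ k)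
    {x : H} (hx : x * jucysMurphy t s l ∈ cosetSpan R t s k M) :
    x * descending s l l * t ∈ cosetSpan R t s k M := by
  induction l generalizing x with
  | zero => simpa [descending, jucysMurphy] using hx
  | succ l ih =>
    have hd : ∀ j, descending s (l + 1) (j + 1) = s (l + 1) * descending s l j := by
      intro j
      induction j with
      | zero => simp [descending]
      | succ j ihj =>
        rw [descending, ihj, mul_assoc, Nat.add_sub_add_right]
        rfl
    rw [hd, ← mul_assoc]
    refine ih (by omega) ?_
    have hq := h.quadratic (l + 1) (by omega) (by omega)
    have : x * s (l + 1) * jucysMurphy t s l =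
        x * jucysMurphy t s (l + 1) * s (l + 1) - c • (x * jucysMurphy t s (l + 1)) := by
      simp only [jucysMurphy]
      rw [show x * (s (l + 1) * jucysMurphy t s l * s (l + 1)) * s (l + 1) =
        x * s (l + 1) * jucysMurphy t s l * (s (l + 1) * s (l + 1)) by simp only [mul_assoc], hq,
        mul_add, mul_smul_comm, mul_one]
      simp only [mul_assoc]
      abel
    rw [this]
    exact sub_mem (h.cosetSpan_mul_s hkn (by omega) hl hx) (Submodule.smul_mem _ _ hx)

/-- The coset span is closed under right multiplication by `t`. -/
lemma cosetSpan_mul_t (h : HeckeSystem c v n t s) (hm : 1 ≤ m) {k : ℕ} (hkn : k + 1 ≤ n)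
    {x : H} (hx : x ∈ cosetSpan R t s k m) : x * t ∈ cosetSpan R t s k m := by
  induction hx using Submodule.span_induction with
  | mem x hx =>
    obtain ⟨w, hw, a, ha, j, hj, rfl⟩ := hx
    -- A run with j < k does not reach s_1, so t commutes with it. The full run s_k ⋯ s_1 followed
    -- by t produces a further factor X_k, whose exponent may reach m.
    rcases hj.lt_or_eq with hj' | rfl
    · have ht : t ∈ parabolic R t s k := t_mem_parabolic t s (by omega)
      refine Submodule.subset_span ⟨w * t, mul_mem hw ht, a, ha, j, hj, ?_⟩
      have hc : jucysMurphy t s k ^ a * t = t * jucysMurphy t s k ^ a :=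
        (h.commute_jucysMurphy hkn ht).pow_left a
      have hd : t * descending s k j = descending s k j * t :=
        commute_descending s (fun i h1 h2 => h.tau_comm _ (by omega) (by omega)) hj
      rw [mul_assoc, ← hd, ← mul_assoc, mul_assoc w, hc, ← mul_assoc]
    · refine h.cosetSpan_mul_mul_t hkn le_rfl ?_
      rw [mul_assoc, ← pow_succ]
      refine mul_mem_cosetSpan hw ?_
      rcases Nat.lt_or_ge (a + 1) m with h1 | h1
      · simpa using mul_jucysMurphy_pow_mem_cosetSpan (one_mem (parabolic R t s j)) h1
      · obtain rfl : a + 1 = m := by omega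
        exact h.jucysMurphy_pow_mem hm hkn
  | zero => simp
  | add x y _ _ hx hy => rw [add_mul]; exact add_mem hx hy
  | smul r x _ hx => rw [smul_mul_assoc]; exact Submodule.smul_mem _ _ hx

/-- The coset span contains 1, since m ≥ 1, and is stable under right multiplication by every
generator of level k + 1. -/
lemma parabolic_le_cosetSpan (h : HeckeSystem c v n t s) (hm : 1 ≤ m) {k : ℕ} (hkn : k + 1 ≤ n) :
    (parabolic R t s (k + 1)).toSubmodule ≤ cosetSpan R t s k m := by
  have key : ∀ w ∈ parabolic R t s (k + 1), ∀ x ∈ cosetSpan R t s k m,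
      x * w ∈ cosetSpan R t s k m := by
    intro w hw
    induction hw using Algebra.adjoin_induction with
    | mem y hy =>
      intro x hx
      rcases hy with ⟨_, rfl⟩ | ⟨i, h1, h2, rfl⟩
      · exact h.cosetSpan_mul_t hm hkn hx
      · exact h.cosetSpan_mul_s hkn h1 (by omega) hx
    | algebraMap r =>
      intro x hx
      rw [← Algebra.commutes, ← Algebra.smul_def]; exact Submodule.smul_mem _ _ hx
    | add y z _ _ hy hz => intro x hx; rw [mul_add]; exact add_mem (hy x hx) (hz x hx)
    | mul y z _ _ hy hz => intro x hx; rw [← mul_assoc]; exact hz _ (hy x hx)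
  intro w hw
  have h1 : (1 : H) ∈ cosetSpan R t s k m := by
    simpa using mul_jucysMurphy_pow_mem_cosetSpan (a := 0) (one_mem (parabolic R t s k))
      (show 0 < m by omega)
  simpa using key w hw 1 h1

end HeckeSystem

/-- The index set of the standard monomials of `H(m,1,n)`. -/
def MonomialIndex (m : ℕ) : ℕ → Type
  | 0 => Unit
  | k + 1 => MonomialIndex m k × (Fin m × Fin (k + 1))

instance MonomialIndex.fintype (m : ℕ) : ∀ k, Fintype (MonomialIndex m k)
  | 0 => inferInstanceAs (Fintype Unit)
  | k + 1 =>
    letI := MonomialIndex.fintype m k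
    inferInstanceAs (Fintype (MonomialIndex m k × (Fin m × Fin (k + 1))))

lemma card_monomialIndex (m n : ℕ) :
    Fintype.card (MonomialIndex m n) = n.factorial * m ^ n := by
  induction n with
  | zero => exact Fintype.card_unit
  | succ k ih =>
    have : Fintype.card (MonomialIndex m (k + 1)) =
        Fintype.card (MonomialIndex m k × (Fin m × Fin (k + 1))) := rfl
    rw [this, Fintype.card_prod, ih, Fintype.card_prod, Fintype.card_fin, Fintype.card_fin,
      Nat.factorial_succ, pow_succ]
    ring

/-- The standard monomials: products over the levels `k` of the elements
`X_{k+1}^a s_k ⋯ s_{k-j+1}`. -/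
def standardMonomial (t : H) (s : ℕ → H) (m : ℕ) : ∀ k, MonomialIndex m k → H
  | 0, _ => 1
  | k + 1, (i, a, j) =>
    standardMonomial t s m k i * jucysMurphy t s k ^ (a : ℕ) * descending s k j

theorem HeckeSystem.parabolic_le_span_standardMonomial {c : R} {m : ℕ} {v : Fin m → R} {n : ℕ}
    {t : H} {s : ℕ → H} (h : HeckeSystem c v n t s) (hm : 1 ≤ m) {k : ℕ} (hkn : k ≤ n) :
    (parabolic R t s k).toSubmodule ≤
      Submodule.span R (Set.range (standardMonomial t s m k)) := by
  induction k with
  | zero =>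
    intro x hx
    have hx' : x ∈ (⊥ : Subalgebra R H) := by
      rw [← Algebra.adjoin_empty R H]
      refine Algebra.adjoin_mono ?_ hx
      rintro x (⟨h1, _⟩ | ⟨i, h1, h2, _⟩) <;> omega
    obtain ⟨r, rfl⟩ := Algebra.mem_bot.1 hx'
    rw [Algebra.algebraMap_eq_smul_one]
    exact Submodule.smul_mem _ _ (Submodule.subset_span ⟨(), rfl⟩)
  | succ k ih =>
    refine (h.parabolic_le_cosetSpan hm hkn).trans (Submodule.span_le.2 ?_)
    rintro x ⟨w, hw, a, ha, j, hj, rfl⟩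
    have hw' := ih (by omega) hw
    clear hw
    induction hw' using Submodule.span_induction with
    | mem w hw =>
      obtain ⟨i, rfl⟩ := hw
      exact Submodule.subset_span ⟨(i, ⟨a, ha⟩, ⟨j, by omega⟩), rfl⟩
    | zero => simp
    | add x y _ _ hx hy => rw [add_mul, add_mul]; exact add_mem hx hy
    | smul r x _ hx => rw [smul_mul_assoc, smul_mul_assoc]; exact Submodule.smul_mem _ _ hx

end Spanning

/-! ### Compatibility of standard monomials with ring homomorphisms -/

section Naturality

variable {H K : Type*} [Ring H] [Ring K] (f : H →+* K) (t : H) (s : ℕ → H)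
  (t' : K) (s' : ℕ → K)

lemma map_standardMonomial (m k : ℕ) (ht : 1 ≤ k → f t = t')
    (hs : ∀ i, 1 ≤ i → i + 1 ≤ k → f (s i) = s' i) (i : MonomialIndex m k) :
    f (standardMonomial t s m k i) = standardMonomial t' s' m k i := by
  have hX : ∀ l, l + 1 ≤ k → f (jucysMurphy t s l) = jucysMurphy t' s' l := by
    intro l
    induction l with
    | zero => exact ht
    | succ l ih =>
      intro hl
      simp only [jucysMurphy, map_mul]
      rw [ih (by omega), hs _ (by omega) hl]
  have hd : ∀ l, l + 1 ≤ k → ∀ j ≤ l, f (descending s l j) = descending s' l j := by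
    intro l hl j hj
    induction j with
    | zero => simp [descending]
    | succ j ih =>
      simp only [descending, map_mul]
      rw [ih (by omega), hs _ (by omega) (by omega)]
  induction k with
  | zero => simp [standardMonomial]
  | succ k ih =>
    obtain ⟨i, a, j⟩ := i
    simp only [standardMonomial, map_mul, map_pow]
    rw [hX k le_rfl, hd k le_rfl _ (by omega),
      ih (fun h => ht (by omega)) (fun i h1 h2 => hs i h1 (by omega)) i
        (fun l h => hX l (by omega)) (fun l h => hd l (by omega))]

end Naturality

/-! ### Words with pairwise distinct letters -/

/-- Infinite words with pairwise distinct letters in `L`. -/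
structure Word (L : Type*) where
  /-- The letter at a given position. -/
  letter : ℕ → L
  injective : Function.Injective letter

namespace Word

variable {L : Type*}

/-- Exchange the letters at the positions `i` and `i + 1`. -/
def exchange (x : Word L) (i : ℕ) : Word L :=
  ⟨x.letter ∘ Equiv.swap i (i + 1), x.injective.comp (Equiv.injective _)⟩

@[ext] lemma ext {x y : Word L} (h : ∀ p, x.letter p = y.letter p) : x = y := by
  cases x; cases y; congr; exact funext h

lemma exchange_val (x : Word L) (i p : ℕ) :
    (x.exchange i).letter p =
      if p = i then x.letter (i + 1) else if p = i + 1 then x.letter i else x.letter p := by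
  simp only [exchange, Function.comp, Equiv.swap_apply_def]
  split_ifs <;> rfl

@[simp] lemma exchange_left (x : Word L) (i : ℕ) : (x.exchange i).letter i = x.letter (i + 1) := by
  simp [exchange_val]

@[simp] lemma exchange_right (x : Word L) (i : ℕ) : (x.exchange i).letter (i + 1) = x.letter i := by
  simp [exchange_val]

lemma exchange_of_ne (x : Word L) {i p : ℕ} (h₁ : p ≠ i) (h₂ : p ≠ i + 1) :
    (x.exchange i).letter p = x.letter p := by
  simp [exchange_val, h₁, h₂]

@[simp] lemma exchange_exchange (x : Word L) (i : ℕ) : (x.exchange i).exchange i = x := by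
  ext p; simp only [exchange_val]; grind

lemma exchange_comm (x : Word L) {i j : ℕ} (h : i + 1 < j) :
    (x.exchange i).exchange j = (x.exchange j).exchange i := by
  ext p; simp only [exchange_val]; grind

lemma exchange_braid (x : Word L) (i : ℕ) :
    ((x.exchange i).exchange (i + 1)).exchange i =
      ((x.exchange (i + 1)).exchange i).exchange (i + 1) := by
  ext p; simp only [exchange_val]; grind

end Word

/-! ### Exchange operators -/

section Operators

variable {R : Type*} [CommRing R] {L : Type*}

/-- The basis vector of a word. -/
noncomputable def wordVec (R : Type*) [CommRing R] {L : Type*} (x : Word L) : Word L →₀ R :=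
  Finsupp.single x 1

/-- The operator that sends a word with the letters `a`, `b` at the positions `i`, `i + 1` to the
word with these letters exchanged, plus `f a b` times the original word. -/
noncomputable def exchangeOp (f : L → L → R) (i : ℕ) : Module.End R (Word L →₀ R) :=
  Finsupp.lsum R fun x => LinearMap.toSpanSingleton R _
    (wordVec R (x.exchange i) + f (x.letter i) (x.letter (i + 1)) • wordVec R x)

/-- The diagonal operator that multiplies a word by a function of its letter at position `p`. -/
noncomputable def letterOp (g : L → R) (p : ℕ) : Module.End R (Word L →₀ R) :=
  Finsupp.lsum R fun x => LinearMap.toSpanSingleton R _ (g (x.letter p) • wordVec R x)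

@[simp] lemma exchangeOp_wordVec (f : L → L → R) (i : ℕ) (x : Word L) :
    exchangeOp f i (wordVec R x) =
      wordVec R (x.exchange i) + f (x.letter i) (x.letter (i + 1)) • wordVec R x := by
  simp [exchangeOp, wordVec]

@[simp] lemma letterOp_wordVec (g : L → R) (p : ℕ) (x : Word L) :
    letterOp g p (wordVec R x) = g (x.letter p) • wordVec R x := by
  simp [letterOp, wordVec]

lemma end_ext {N : Type*} [AddCommMonoid N] [Module R N] {A B : (Word L →₀ R) →ₗ[R] N}
    (h : ∀ x, A (wordVec R x) = B (wordVec R x)) : A = B :=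
  Finsupp.lhom_ext' fun x => LinearMap.ext_ring (h x)

lemma exchangeOp_commute (f g : L → L → R) {i j : ℕ} (h : i + 1 < j) :
    Commute (exchangeOp f i) (exchangeOp g j) := by
  refine end_ext fun x => ?_
  simp only [Module.End.mul_apply, exchangeOp_wordVec, map_add, map_smul]
  rw [x.exchange_of_ne (i := i) (p := j) (by omega) (by omega),
    x.exchange_of_ne (i := i) (p := j + 1) (by omega) (by omega),
    x.exchange_of_ne (i := j) (p := i) (by omega) (by omega),
    x.exchange_of_ne (i := j) (p := i + 1) (by omega) (by omega), x.exchange_comm h]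
  module

lemma exchangeOp_commute' {f g : L → L → R} {i j : ℕ} (h : i + 1 < j ∨ j + 1 < i) :
    Commute (exchangeOp f i) (exchangeOp g j) := by
  rcases h with h | h
  · exact exchangeOp_commute f g h
  · exact (exchangeOp_commute g f h).symm

lemma exchangeOp_zero_mul_self (i : ℕ) :
    (exchangeOp (fun _ _ => 0) i * exchangeOp (fun _ _ => 0) i :
      Module.End R (Word L →₀ R)) = 1 := by
  refine end_ext fun x => ?_
  simp

lemma letterOp_commute_exchangeOp (g : L → R) (f : L → L → R) {p i : ℕ} (h₁ : p ≠ i)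
    (h₂ : p ≠ i + 1) : Commute (letterOp g p) (exchangeOp f i) := by
  refine end_ext fun x => ?_
  simp only [Module.End.mul_apply, exchangeOp_wordVec, letterOp_wordVec, map_add, map_smul]
  rw [x.exchange_of_ne h₁ h₂]
  module

/-- A criterion for a Yang–Baxter equation between three exchange operators. -/
lemma exchangeOp_yangBaxter (f g h : L → L → R)
    (h₁ : ∀ a b d, a ≠ b → a ≠ d → b ≠ d → g a d * f d b + h b d * g a b = f a b * h a d)
    (h₂ : ∀ a b d, a ≠ b → a ≠ d → b ≠ d → h b d * f a d = g a d * h b a + f a b * g b d)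
    (h₃ : ∀ a b d, a ≠ b → a ≠ d → b ≠ d → h b d * g a b * f b d = f a b * g b d * h a b)
    (i : ℕ) :
    exchangeOp f (i + 1) * exchangeOp g i * exchangeOp h (i + 1) =
      exchangeOp h i * exchangeOp g (i + 1) * exchangeOp f i := by
  refine end_ext fun x => ?_
  have e0 : ∀ y : Word L, (y.exchange i).letter (i + 1 + 1) = y.letter (i + 1 + 1) :=
    fun y => y.exchange_of_ne (by omega) (by omega)
  have e1 : ∀ y : Word L, (y.exchange (i + 1)).letter i = y.letter i :=
    fun y => y.exchange_of_ne (by omega) (by omega)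
  simp only [Module.End.mul_apply, exchangeOp_wordVec, map_add, map_smul, e0, e1,
    Word.exchange_left, Word.exchange_right, Word.exchange_exchange, x.exchange_braid]
  have hab : x.letter i ≠ x.letter (i + 1) := x.injective.ne (by omega)
  have had : x.letter i ≠ x.letter (i + 1 + 1) := x.injective.ne (by omega)
  have hbd : x.letter (i + 1) ≠ x.letter (i + 1 + 1) := x.injective.ne (by omega)
  generalize x.letter i = a at *
  generalize x.letter (i + 1) = b at *
  generalize x.letter (i + 1 + 1) = d at *
  -- The coefficients of the words reached by two or three exchanges agree automatically. The three
  -- hypotheses are the comparisons at the two words reached by one exchange and at `x` itself.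
  linear_combination (norm := module) (h₁ a b d hab had hbd) • wordVec R (x.exchange (i + 1)) +
    (h₂ a b d hab had hbd) • wordVec R (x.exchange i) + (h₃ a b d hab had hbd) • wordVec R x

/-- A criterion for the equality of two products of exchange operators at the same position. -/
lemma exchangeOp_mul_eq (f g f' g' : L → L → R)
    (h₁ : ∀ a b, a ≠ b → f b a + g a b = f' b a + g' a b)
    (h₂ : ∀ a b, a ≠ b → g a b * f a b = g' a b * f' a b) (i : ℕ) :
    exchangeOp f i * exchangeOp g i = exchangeOp f' i * exchangeOp g' i := by
  refine end_ext fun x => ?_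
  simp only [Module.End.mul_apply, exchangeOp_wordVec, map_add, map_smul,
    Word.exchange_left, Word.exchange_right, Word.exchange_exchange]
  have hab : x.letter i ≠ x.letter (i + 1) := x.injective.ne (by omega)
  generalize x.letter i = a at *
  generalize x.letter (i + 1) = b at *
  linear_combination (norm := module) (h₁ a b hab) • wordVec R (x.exchange i) +
    (h₂ a b hab) • wordVec R x

end Operators

/-! ### Intertwining products -/

section Products

variable {A : Type*} [Monoid A]

/-- The product `s_k ⋯ s_1 z`. -/
def leftProduct (z : A) (s : ℕ → A) : ℕ → A
  | 0 => z
  | k + 1 => s (k + 1) * leftProduct z s k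

variable {z : A} {s t t' : ℕ → A}

lemma leftProduct_commute {k : ℕ} {y : A} (hz : Commute z y)
    (hs : ∀ i, 1 ≤ i → i ≤ k → Commute (s i) y) : Commute (leftProduct z s k) y := by
  induction k with
  | zero => exact hz
  | succ k ih =>
    exact (hs _ (by omega) le_rfl).mul_left (ih fun i h1 h2 => hs i h1 (by omega))

/-- If the pairs `s_{i+1} s_i` shift the index of `t`, so does `s_k ⋯ s_1 z`. -/
lemma leftProduct_shift (hst : ∀ i j, i + 1 < j ∨ j + 1 < i → Commute (s i) (t j))
    (hz : ∀ i, 2 ≤ i → Commute z (t i))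
    (hyb : ∀ i, s (i + 1) * s i * t (i + 1) = t i * s (i + 1) * s i)
    {k i : ℕ} (hi : 1 ≤ i) (hik : i + 1 ≤ k) :
    leftProduct z s k * t (i + 1) = t i * leftProduct z s k := by
  induction k with
  | zero => omega
  | succ k ih =>
    rcases Nat.lt_or_ge i k with h | h
    · change s (k + 1) * leftProduct z s k * t (i + 1) = t i * (s (k + 1) * leftProduct z s k)
      rw [mul_assoc, ih h, ← mul_assoc, (hst (k + 1) i (by omega)).eq, mul_assoc]
    · obtain rfl : i = k := by omega
      obtain ⟨i, rfl⟩ : ∃ j, i = j + 1 := ⟨i - 1, by omega⟩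
      have hc : leftProduct z s i * t (i + 1 + 1) = t (i + 1 + 1) * leftProduct z s i :=
        leftProduct_commute (hz _ (by omega)) fun j _ _ => hst _ _ (by omega)
      change s (i + 1 + 1) * (s (i + 1) * leftProduct z s i) * t (i + 1 + 1) =
        t (i + 1) * (s (i + 1 + 1) * (s (i + 1) * leftProduct z s i))
      calc _ = s (i + 1 + 1) * s (i + 1) * (leftProduct z s i * t (i + 1 + 1)) := by
            simp only [mul_assoc]
        _ = s (i + 1 + 1) * s (i + 1) * t (i + 1 + 1) * leftProduct z s i := by
            rw [hc]; simp only [mul_assoc]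
        _ = _ := by rw [hyb]; simp only [mul_assoc]

/-- The square of `s_k ⋯ s_1 z` carries `t_1` to `t_k`. -/
lemma leftProduct_sq (hss : ∀ i j, i + 1 < j ∨ j + 1 < i → Commute (s i) (s j))
    (hz : ∀ i, 2 ≤ i → Commute z (s i))
    (hyb : ∀ i, s i * s (i + 1) * t' i = t' (i + 1) * s i * s (i + 1))
    (hst : ∀ i, s i * t' i = t i * s i)
    (hone : z * s 1 * z * t 1 = t' 1 * (z * s 1 * z)) (k : ℕ) :
    leftProduct z s (k + 1) * leftProduct z s (k + 1) * t 1 =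
      t (k + 1) * (leftProduct z s (k + 1) * leftProduct z s (k + 1)) := by
  -- Write L_k for s_k ⋯ s_1 z. Then L_{k+1}² = s_{k+1} (L_k L_{k+1}) and L_{k+1} L_{k+2} = s_{k+1}
  -- s_{k+2} (L_k L_{k+1}), so the induction runs on L_k L_{k+1}, which carries t_1 to t'_{k+1}.
  have key : ∀ k, leftProduct z s k * leftProduct z s (k + 1) * t 1 =
      t' (k + 1) * (leftProduct z s k * leftProduct z s (k + 1)) := by
    intro k
    induction k with
    | zero => simpa [leftProduct, mul_assoc] using hone
    | succ k ih =>
      have hc : leftProduct z s k * s (k + 1 + 1) = s (k + 1 + 1) * leftProduct z s k :=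
        leftProduct_commute (hz _ (by omega)) fun j _ _ => hss _ _ (by omega)
      have e : leftProduct z s (k + 1) * leftProduct z s (k + 1 + 1) =
          s (k + 1) * s (k + 1 + 1) * (leftProduct z s k * leftProduct z s (k + 1)) := by
        change s (k + 1) * leftProduct z s k * (s (k + 1 + 1) * leftProduct z s (k + 1)) = _
        rw [mul_assoc, ← mul_assoc (leftProduct z s k), hc]
        simp only [mul_assoc]
      rw [e, mul_assoc, ih, ← mul_assoc, hyb]
      simp only [mul_assoc]
  have e : leftProduct z s (k + 1) * leftProduct z s (k + 1) =
      s (k + 1) * (leftProduct z s k * leftProduct z s (k + 1)) := mul_assoc _ _ _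
  rw [e, mul_assoc, key, ← mul_assoc, hst, mul_assoc]

end Products

/-! ### The representation on coloured words -/

section Representation

variable {R : Type*} [CommRing R] (c : R) {L : Type*} [LinearOrder L] {m : ℕ} (col : L → Fin m)

/-- The coefficients of the operators of the `σ_i`. -/
def sigmaCoeff (a b : L) : R := if b < a then c else 0

/-- The coefficients of the inverses of the operators of the `σ_i`. -/
def sigmaInvCoeff (a b : L) : R := if a < b then -c else 0

/-- The coefficients of the operators that agree with those of the `σ_i` on letters of the same
colour and exchange letters of different colours. -/
def colourCoeff (a b : L) : R := if col a = col b ∧ b < a then c else 0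

/-- The coefficients of the operators of the `σ_i` for the order of the letters in which the order
of the colours is reversed. -/
def sigmaRevCoeff (a b : L) : R := if (col a = col b ∧ b < a) ∨ col a < col b then c else 0

/-- The operator of `σ_i`. -/
noncomputable abbrev sigmaOp (i : ℕ) : Module.End R (Word L →₀ R) := exchangeOp (sigmaCoeff c) i

/-- The inverse of the operator of `σ_i`. -/
noncomputable abbrev sigmaInvOp (i : ℕ) : Module.End R (Word L →₀ R) :=
  exchangeOp (sigmaInvCoeff c) i

/-- The operator that agrees with that of `σ_i` on letters of the same colour and exchanges
letters of different colours. -/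
noncomputable abbrev colourOp (i : ℕ) : Module.End R (Word L →₀ R) :=
  exchangeOp (colourCoeff c col) i

/-- The operator of `σ_i` for the order of the letters with the reversed order of the colours. -/
noncomputable abbrev sigmaRevOp (i : ℕ) : Module.End R (Word L →₀ R) :=
  exchangeOp (sigmaRevCoeff c col) i

/-- The coefficients depend only on the relative order of the letters, which leaves finitely many
cases. The later identities that involve colours are checked in the same way, with `hcol` linking
colours to the order. -/
lemma sigmaOp_braid (i : ℕ) : sigmaOp c (i + 1) * sigmaOp c i * sigmaOp c (i + 1) =
    (sigmaOp c i * sigmaOp c (i + 1) * sigmaOp c i : Module.End R (Word L →₀ R)) := by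
  refine exchangeOp_yangBaxter _ _ _ ?_ ?_ ?_ i <;> intro a b d h1 h2 h3 <;>
    simp only [sigmaCoeff] <;> split_ifs <;> first | ring1 | (exfalso; grind)

lemma sigmaOp_quadratic (i : ℕ) :
    sigmaOp c i * sigmaOp c i = c • (sigmaOp c i : Module.End R (Word L →₀ R)) + 1 := by
  refine end_ext fun x => ?_
  simp only [Module.End.mul_apply, exchangeOp_wordVec, map_add, map_smul,
    Word.exchange_left, Word.exchange_right, Word.exchange_exchange, LinearMap.add_apply,
    LinearMap.smul_apply, Module.End.one_apply]
  have hab : x.letter i ≠ x.letter (i + 1) := x.injective.ne (by omega)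
  simp only [sigmaCoeff]
  rcases hab.lt_or_gt with h | h
  · simp only [h, h.not_gt, if_true, if_false]; module
  · simp only [h, h.not_gt, if_true, if_false]; module

lemma sigmaOp_mul_sigmaInvOp (i : ℕ) :
    sigmaOp c i * sigmaInvOp c i = (1 : Module.End R (Word L →₀ R)) := by
  rw [← exchangeOp_zero_mul_self i]
  refine exchangeOp_mul_eq _ _ _ _ ?_ ?_ i <;> intro a b h1 <;>
    simp only [sigmaCoeff, sigmaInvCoeff] <;> split_ifs <;> first | ring1 | (exfalso; grind)

lemma sigmaInvOp_mul_sigmaOp (i : ℕ) :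
    sigmaInvOp c i * sigmaOp c i = (1 : Module.End R (Word L →₀ R)) := by
  rw [← exchangeOp_zero_mul_self i]
  refine exchangeOp_mul_eq _ _ _ _ ?_ ?_ i <;> intro a b h1 <;>
    simp only [sigmaCoeff, sigmaInvCoeff] <;> split_ifs <;> first | ring1 | (exfalso; grind)

/-- On letters of equal colour the three operators coincide. On different colours `colourOp` is the
plain exchange, which interchanges the two orders. -/
lemma colourOp_mul_sigmaRevOp (hcol : Monotone col) (i : ℕ) :
    colourOp c col i * sigmaRevOp c col i = sigmaOp c i * colourOp c col i := by
  refine exchangeOp_mul_eq _ _ _ _ ?_ ?_ i <;> intro a b h1 <;>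
    have m1 := @hcol a b <;> have m2 := @hcol b a <;>
    simp only [sigmaCoeff, sigmaRevCoeff, colourCoeff] <;> split_ifs <;>
    first | ring1 | (exfalso; grind)

lemma colourOp_mul_sigmaOp (hcol : Monotone col) (i : ℕ) :
    colourOp c col i * sigmaOp c i = sigmaRevOp c col i * colourOp c col i := by
  refine exchangeOp_mul_eq _ _ _ _ ?_ ?_ i <;> intro a b h1 <;>
    have m1 := @hcol a b <;> have m2 := @hcol b a <;>
    simp only [sigmaCoeff, sigmaRevCoeff, colourCoeff] <;> split_ifs <;>
    first | ring1 | (exfalso; grind)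

lemma colourOp_shift_sigmaOp (hcol : Monotone col) (i : ℕ) :
    colourOp c col (i + 1) * colourOp c col i * sigmaOp c (i + 1) =
      sigmaOp c i * colourOp c col (i + 1) * colourOp c col i := by
  refine exchangeOp_yangBaxter _ _ _ ?_ ?_ ?_ i <;> intro a b d h1 h2 h3 <;>
    have m1 := @hcol a b <;> have m2 := @hcol b a <;> have m3 := @hcol a d <;>
    have m4 := @hcol d a <;> have m5 := @hcol b d <;> have m6 := @hcol d b <;>
    simp only [sigmaCoeff, colourCoeff] <;> split_ifs <;>
    first | ring1 | (exfalso; grind)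

lemma colourOp_shift_sigmaRevOp (hcol : Monotone col) (i : ℕ) :
    colourOp c col i * colourOp c col (i + 1) * sigmaRevOp c col i =
      sigmaRevOp c col (i + 1) * colourOp c col i * colourOp c col (i + 1) := by
  symm
  refine exchangeOp_yangBaxter _ _ _ ?_ ?_ ?_ i <;> intro a b d h1 h2 h3 <;>
    have m1 := @hcol a b <;> have m2 := @hcol b a <;> have m3 := @hcol a d <;>
    have m4 := @hcol d a <;> have m5 := @hcol b d <;> have m6 := @hcol d b <;>
    simp only [sigmaRevCoeff, colourCoeff] <;> split_ifs <;>
    first | ring1 | (exfalso; grind)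

variable (v : Fin m → R)

/-- Multiplication by the parameter attached to the colour of the first letter. -/
noncomputable abbrev colourEval : Module.End R (Word L →₀ R) := letterOp (fun a => v (col a)) 1

/-- The product `σ_1⁻¹ ⋯ σ_k⁻¹` of operators. -/
noncomputable def sigmaInvProd (c : R) : ℕ → Module.End R (Word L →₀ R)
  | 0 => 1
  | k + 1 => sigmaInvProd c k * sigmaInvOp c (k + 1)

/-- The operator of `τ` on words, of which the letters at the positions `1, …, k + 1` are used. -/
noncomputable def tauOp (k : ℕ) : Module.End R (Word L →₀ R) :=
  sigmaInvProd c k * leftProduct (colourEval col v) (colourOp c col) k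

lemma sigmaInvProd_mul_leftProduct (k : ℕ) :
    (sigmaInvProd c k * leftProduct 1 (sigmaOp c) k : Module.End R (Word L →₀ R)) = 1 := by
  induction k with
  | zero => rfl
  | succ k ih =>
    change sigmaInvProd c k * sigmaInvOp c (k + 1) * (sigmaOp c (k + 1) * _) = _
    rw [mul_assoc, ← mul_assoc (sigmaInvOp c (k + 1)), sigmaInvOp_mul_sigmaOp, one_mul, ih]

lemma leftProduct_mul_sigmaInvProd (k : ℕ) :
    (leftProduct 1 (sigmaOp c) k * sigmaInvProd c k : Module.End R (Word L →₀ R)) = 1 := by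
  induction k with
  | zero => rfl
  | succ k ih =>
    change sigmaOp c (k + 1) * leftProduct 1 (sigmaOp c) k * (sigmaInvProd c k * _) = _
    rw [mul_assoc, ← mul_assoc (leftProduct 1 (sigmaOp c) k), ih, one_mul, sigmaOp_mul_sigmaInvOp]

lemma leftProduct_mul_tauOp (k : ℕ) : leftProduct 1 (sigmaOp c) k * tauOp c col v k =
    leftProduct (colourEval col v) (colourOp c col) k := by
  rw [tauOp, ← mul_assoc, leftProduct_mul_sigmaInvProd, one_mul]

lemma isUnit_sigmaOp (i : ℕ) : IsUnit (sigmaOp c i : Module.End R (Word L →₀ R)) :=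
  ⟨⟨_, _, sigmaOp_mul_sigmaInvOp c i, sigmaInvOp_mul_sigmaOp c i⟩, rfl⟩

lemma isUnit_leftProduct_sigmaOp (k : ℕ) :
    IsUnit (leftProduct 1 (sigmaOp c) k : Module.End R (Word L →₀ R)) :=
  ⟨⟨_, _, leftProduct_mul_sigmaInvProd c k, sigmaInvProd_mul_leftProduct c k⟩, rfl⟩

/-- With Q = σ_k ⋯ σ_1 and P = S_k ⋯ S_1 ϖ, where S_i is `colourOp` and ϖ is `colourEval`, the
operator of τ is Q⁻¹ P. Both Q and P carry σ_i to σ_{i-1}, so Q⁻¹ P commutes with σ_i. -/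
lemma tauOp_commute_sigmaOp (hcol : Monotone col) {k i : ℕ} (hi : 2 ≤ i) (hik : i ≤ k) :
    Commute (tauOp c col v k) (sigmaOp c i) := by
  obtain ⟨i, rfl⟩ : ∃ j, i = j + 1 := ⟨i - 1, by omega⟩
  have hQ : leftProduct 1 (sigmaOp c) k * sigmaOp c (i + 1) =
      (sigmaOp c i * leftProduct 1 (sigmaOp c) k : Module.End R (Word L →₀ R)) :=
    leftProduct_shift (fun _ _ h => exchangeOp_commute' h) (fun _ _ => Commute.one_left _)
      (sigmaOp_braid c) (by omega) hik
  have hρ : leftProduct (colourEval col v) (colourOp c col) k * sigmaOp c (i + 1) =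
      sigmaOp c i * leftProduct (colourEval col v) (colourOp c col) k :=
    leftProduct_shift (fun _ _ h => exchangeOp_commute' h)
      (fun _ _ => letterOp_commute_exchangeOp _ _ (by omega) (by omega))
      (colourOp_shift_sigmaOp c col hcol) (by omega) hik
  refine (isUnit_leftProduct_sigmaOp c k).mul_left_cancel ?_
  rw [← mul_assoc, leftProduct_mul_tauOp, hρ, ← leftProduct_mul_tauOp, ← mul_assoc, ← hQ,
    mul_assoc]

/-- The diagonal term of S_1 occurs only for equal colours. Hence ϖ S_1 ϖ is S_1 times the product
of the parameters of the first two letters. This scalar is symmetric in the two letters, so the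
claim reduces to `colourOp_mul_sigmaOp`. -/
lemma colourEval_colourOp (hcol : Monotone col) :
    colourEval col v * colourOp c col 1 * colourEval col v * sigmaOp c 1 =
      sigmaRevOp c col 1 * (colourEval col v * colourOp c col 1 * colourEval col v) := by
  have key : ∀ x : Word L,
      (colourEval col v * colourOp c col 1 * colourEval col v) (wordVec R x) =
        (v (col (x.letter 1)) * v (col (x.letter 2))) • colourOp c col 1 (wordVec R x) := by
    intro x
    simp only [Module.End.mul_apply, exchangeOp_wordVec, letterOp_wordVec, map_add, map_smul,
      Word.exchange_left, colourCoeff]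
    split_ifs with h
    · rw [h.1]; module
    · module
  refine end_ext fun x => ?_
  have h := LinearMap.congr_fun (colourOp_mul_sigmaOp c col hcol 1) (wordVec R x)
  have h' : (colourEval col v * colourOp c col 1 * colourEval col v) (sigmaOp c 1 (wordVec R x)) =
      (v (col (x.letter 1)) * v (col (x.letter 2))) •
        colourOp c col 1 (sigmaOp c 1 (wordVec R x)) := by
    rw [exchangeOp_wordVec (sigmaCoeff c), map_add, map_smul, map_add, map_smul, key, key,
      Word.exchange_left, show (x.exchange 1).letter 2 = x.letter 1 from x.exchange_right 1]
    module
  rw [Module.End.mul_apply _ (sigmaOp c 1), Module.End.mul_apply (sigmaRevOp c col 1), key,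
    map_smul, ← Module.End.mul_apply (sigmaRevOp c col 1), ← h, h', Module.End.mul_apply]

/-- Write Q = Q' σ_1 with Q' commuting with τ. Then (Q τ)² = Q Q' (τ σ_1 τ) and Q² = Q Q' σ_1. By
`leftProduct_sq` both squares carry σ_1 to σ_{k+1}. Hence Q Q' does so too, and cancelling it shows
that τ σ_1 τ commutes with σ_1. -/
lemma tauOp_braid (hcol : Monotone col) (k : ℕ) :
    tauOp c col v (k + 1) * sigmaOp c 1 * tauOp c col v (k + 1) * sigmaOp c 1 =
      sigmaOp c 1 * tauOp c col v (k + 1) * sigmaOp c 1 * tauOp c col v (k + 1) := by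
  have hρ := leftProduct_sq (z := colourEval col v) (s := colourOp c col) (t := sigmaOp c)
    (t' := sigmaRevOp c col) (fun _ _ h => exchangeOp_commute' h)
    (fun _ _ => letterOp_commute_exchangeOp _ _ (by omega) (by omega))
    (colourOp_shift_sigmaRevOp c col hcol) (colourOp_mul_sigmaRevOp c col hcol)
    (colourEval_colourOp c col v hcol) k
  have hQ := leftProduct_sq (z := (1 : Module.End R (Word L →₀ R))) (s := sigmaOp c)
    (t := sigmaOp c) (t' := sigmaOp c) (fun _ _ h => exchangeOp_commute' h)
    (fun _ _ => Commute.one_left _) (fun i => (sigmaOp_braid c i).symm) (fun _ => rfl) (by simp) k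
  obtain ⟨Q', hQ'⟩ : ∃ Q', leftProduct 1 (sigmaOp c) (k + 1) = Q' * (sigmaOp c 1) ∧
      Commute (tauOp c col v (k + 1)) Q' := by
    have : ∀ l ≤ k, ∃ Q', leftProduct 1 (sigmaOp c) (l + 1) = Q' * (sigmaOp c 1) ∧
        Commute (tauOp c col v (k + 1)) Q' := by
      intro l hl
      induction l with
      | zero => exact ⟨1, by simp [leftProduct], Commute.one_right _⟩
      | succ l ih =>
        obtain ⟨Q', h1, h2⟩ := ih (by omega)
        refine ⟨sigmaOp c (l + 1 + 1) * Q', ?_, ?_⟩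
        · rw [leftProduct, h1, mul_assoc]
        · exact (tauOp_commute_sigmaOp c col v hcol (by omega) (by omega)).mul_right h2
    exact this k le_rfl
  have hX := leftProduct_mul_tauOp c col v (k + 1)
  have hQu := isUnit_leftProduct_sigmaOp (L := L) c (k + 1)
  have hTu := isUnit_sigmaOp (L := L) c 1
  obtain ⟨hQ1, hQc⟩ := hQ'
  rw [← hX] at hρ
  set Q := leftProduct (1 : Module.End R (Word L →₀ R)) (sigmaOp c) (k + 1)
  set X := tauOp c col v (k + 1)
  generalize (sigmaOp c (k + 1) : Module.End R (Word L →₀ R)) = Tk at *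
  generalize (sigmaOp c 1 : Module.End R (Word L →₀ R)) = T at *
  have hQ'u : IsUnit (Q * Q') := by
    have : IsUnit Q' := by
      obtain ⟨u, hu⟩ := hTu
      have : Q' = Q * ↑u⁻¹ := by rw [hQ1, ← hu, mul_assoc, Units.mul_inv, mul_one]
      rw [this]
      exact hQu.mul (Units.isUnit _)
    exact hQu.mul this
  have h1 : Tk * (Q * Q') = Q * Q' * T := by
    refine hTu.mul_right_cancel ?_
    calc Tk * (Q * Q') * T = Tk * (Q * (Q' * T)) := by simp only [mul_assoc]
      _ = Q * (Q' * T) * T := by rw [← hQ1, ← hQ]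
      _ = _ := by simp only [mul_assoc]
  have h2 : Q * X * (Q * X) = Q * Q' * (X * T * X) := by
    calc Q * X * (Q * X) = Q * (X * Q') * T * X := by
          nth_rewrite 2 [hQ1]; simp only [mul_assoc]
      _ = _ := by rw [hQc.eq]; simp only [mul_assoc]
  refine hQ'u.mul_left_cancel ?_
  calc Q * Q' * (X * T * X * T) = Q * X * (Q * X) * T := by rw [h2]; simp only [mul_assoc]
    _ = Tk * (Q * Q') * (X * T * X) := by rw [hρ, h2]; simp only [mul_assoc]
    _ = _ := by rw [h1]; simp only [mul_assoc]

end Representation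

/-! ### The cyclotomic relation -/

section Cyclotomic

variable {R : Type*} [CommRing R] {L : Type*}

variable (R L) in
/-- The span of the words whose letter at position `p` satisfies `P`. -/
noncomputable def letterSpan (P : L → Prop) (p : ℕ) : Submodule R (Word L →₀ R) :=
  Submodule.span R {y | ∃ x : Word L, P (x.letter p) ∧ y = wordVec R x}

lemma map_mem_of_mem_letterSpan {P : L → Prop} {p : ℕ} (f : Module.End R (Word L →₀ R))
    {N : Submodule R (Word L →₀ R)} (h : ∀ x : Word L, P (x.letter p) → f (wordVec R x) ∈ N)
    {y : Word L →₀ R} (hy : y ∈ letterSpan R L P p) : f y ∈ N := by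
  have : letterSpan R L P p ≤ N.comap f := Submodule.span_le.2 (by
    rintro _ ⟨x, hx, rfl⟩
    exact h x hx)
  exact this hy

lemma wordVec_mem_letterSpan {P : L → Prop} {p : ℕ} {x : Word L} (hx : P (x.letter p)) :
    wordVec R x ∈ letterSpan R L P p :=
  Submodule.subset_span ⟨x, hx, rfl⟩

variable (c : R) [LinearOrder L] {m : ℕ} (col : L → Fin m) (v : Fin m → R)

/-- `σ_1⁻¹ ⋯ σ_k⁻¹` carries words with a letter of low colour at position `k + 1` to combinations
of words with a letter of low colour at position `1`. -/
lemma sigmaInvProd_mem_letterSpan (hcol : Monotone col) (γ : ℕ) (k : ℕ) {y : Word L →₀ R}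
    (hy : y ∈ letterSpan R L (fun a => (col a : ℕ) < γ) (k + 1)) :
    sigmaInvProd c k y ∈ letterSpan R L (fun a => (col a : ℕ) < γ) 1 := by
  induction k generalizing y with
  | zero => exact hy
  | succ k ih =>
    refine ih (map_mem_of_mem_letterSpan _ (fun x hx => ?_) hy)
    rw [exchangeOp_wordVec]
    refine add_mem (wordVec_mem_letterSpan (by rwa [Word.exchange_left])) ?_
    rw [sigmaInvCoeff]
    split_ifs with hlt
    -- The unexchanged word occurs only if its letter at position k + 1 is smaller than the next
    -- one. By monotonicity that letter has low colour as well.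
    · exact Submodule.smul_mem _ _ (wordVec_mem_letterSpan
        (lt_of_le_of_lt (Fin.le_def.1 (hcol hlt.le)) hx))
    · rw [zero_smul]; exact zero_mem _

/-- Each factor either moves the tracked letter one position to the right or keeps the word, and the
latter only if the next letter has the same colour. -/
lemma leftProduct_colourOp_mem_letterSpan (j : Fin m) (k : ℕ) {y : Word L →₀ R}
    (hy : y ∈ letterSpan R L (fun a => col a = j) 1) :
    leftProduct 1 (colourOp c col) k y ∈ letterSpan R L (fun a => col a = j) (k + 1) := by
  induction k with
  | zero => exact hy
  | succ k ih =>
    rw [leftProduct, Module.End.mul_apply]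
    refine map_mem_of_mem_letterSpan _ (fun x hx => ?_) ih
    rw [exchangeOp_wordVec]
    refine add_mem (wordVec_mem_letterSpan (by rwa [Word.exchange_right])) ?_
    rw [colourCoeff]
    split_ifs with h
    · exact Submodule.smul_mem _ _ (wordVec_mem_letterSpan (h.1.symm.trans hx))
    · rw [zero_smul]; exact zero_mem _

/-- The difference vanishes unless the letter at position p + 1 has strictly smaller colour than the
one at position p. In that case it is -c times the exchanged word. -/
lemma sigmaInvOp_mul_colourOp_sub_one (hcol : Monotone col) (p : ℕ) (x : Word L) :
    (sigmaInvOp c p * colourOp c col p - 1 : Module.End R (Word L →₀ R)) (wordVec R x) ∈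
      letterSpan R L (fun a => (col a : ℕ) < col (x.letter p)) p := by
  have e : (sigmaInvOp c p * colourOp c col p - 1 : Module.End R (Word L →₀ R)) (wordVec R x) =
      (sigmaInvCoeff c (x.letter (p + 1)) (x.letter p) +
        colourCoeff c col (x.letter p) (x.letter (p + 1))) • wordVec R (x.exchange p) +
      (colourCoeff c col (x.letter p) (x.letter (p + 1)) *
        sigmaInvCoeff c (x.letter p) (x.letter (p + 1))) • wordVec R x := by
    simp only [LinearMap.sub_apply, Module.End.mul_apply, exchangeOp_wordVec, map_add, map_smul,
      Word.exchange_left, Word.exchange_right, Word.exchange_exchange, Module.End.one_apply]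
    module
  rw [e]
  have h2 : colourCoeff c col (x.letter p) (x.letter (p + 1)) *
      sigmaInvCoeff c (x.letter p) (x.letter (p + 1)) = 0 := by
    simp only [colourCoeff, sigmaInvCoeff]
    split_ifs with h h'
    · exact absurd h.2 h'.not_gt
    all_goals simp
  rw [h2, zero_smul, add_zero]
  by_cases hlt : x.letter (p + 1) < x.letter p
  · by_cases hc : col (x.letter p) = col (x.letter (p + 1))
    · simp [colourCoeff, sigmaInvCoeff, hlt, hc]
    · refine Submodule.smul_mem _ _ (wordVec_mem_letterSpan ?_)
      rw [Word.exchange_left]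
      exact Fin.lt_def.1 (lt_of_le_of_ne (hcol hlt.le) (Ne.symm hc))
  · simp [colourCoeff, sigmaInvCoeff, hlt]

lemma leftProduct_eq_mul {A : Type*} [Monoid A] (z : A) (s : ℕ → A) (k : ℕ) :
    leftProduct z s k = leftProduct 1 s k * z := by
  induction k with
  | zero => simp [leftProduct]
  | succ k ih => rw [leftProduct, leftProduct, ih, mul_assoc]

/-- The operator of `τ` is triangular with respect to the colour of the first letter. -/
lemma tauOp_sub_mem (hcol : Monotone col) (k : ℕ) (x : Word L) :
    tauOp c col v k (wordVec R x) - v (col (x.letter 1)) • wordVec R x ∈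
      letterSpan R L (fun a => (col a : ℕ) < col (x.letter 1)) 1 := by
  have key : ∀ k, (sigmaInvProd c k * leftProduct 1 (colourOp c col) k :
      Module.End R (Word L →₀ R)) (wordVec R x) - wordVec R x ∈
        letterSpan R L (fun a => (col a : ℕ) < col (x.letter 1)) 1 := by
    intro k
    induction k with
    | zero => simp [sigmaInvProd, leftProduct]
    | succ k ih =>
      -- The product is telescoped: the innermost pair T⁻¹ S is replaced by 1 plus an error, and the
      -- outer T⁻¹ carry the error to words whose first letter has lower colour.
      have e : (sigmaInvProd c (k + 1) * leftProduct 1 (colourOp c col) (k + 1) :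
          Module.End R (Word L →₀ R)) (wordVec R x) - wordVec R x =
          sigmaInvProd c k
            ((sigmaInvOp c (k + 1) * colourOp c col (k + 1) - 1 : Module.End R (Word L →₀ R))
            (leftProduct 1 (colourOp c col) k (wordVec R x))) +
          ((sigmaInvProd c k * leftProduct 1 (colourOp c col) k :
            Module.End R (Word L →₀ R)) (wordVec R x) - wordVec R x) := by
        simp only [sigmaInvProd, leftProduct, Module.End.mul_apply, LinearMap.sub_apply,
          Module.End.one_apply, map_sub]
        abel
      rw [e]
      refine add_mem (sigmaInvProd_mem_letterSpan c col hcol _ k ?_) ih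
      refine map_mem_of_mem_letterSpan _ (fun y hy => ?_)
        (leftProduct_colourOp_mem_letterSpan c col (col (x.letter 1)) k
          (wordVec_mem_letterSpan rfl))
      rw [← hy]
      exact sigmaInvOp_mul_colourOp_sub_one c col hcol _ _
  rw [tauOp, leftProduct_eq_mul, ← mul_assoc, Module.End.mul_apply, letterOp_wordVec, map_smul,
    ← smul_sub]
  exact Submodule.smul_mem _ _ (key k)

/-- Each factor lowers the filtration by one step. The last factor of the product acts first, which
matches the index of the top step. -/
lemma prod_ofFn_apply_mem {M : Type*} [AddCommGroup M] [Module R M] (N : ℕ → Submodule R M)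
    {m : ℕ} (f : Fin m → Module.End R M) (h : ∀ j : Fin m, ∀ y ∈ N (j + 1), f j y ∈ N j)
    {y : M} (hy : y ∈ N m) : (List.ofFn f).prod y ∈ N 0 := by
  induction m generalizing y with
  | zero => simpa using hy
  | succ m ih =>
    rw [List.ofFn_succ', List.concat_eq_append, List.prod_append, List.prod_singleton,
      Module.End.mul_apply]
    exact ih (fun j => f j.castSucc) (fun j => h j.castSucc) (h (Fin.last m) y hy)

/-- Words whose first letter has colour below γ span a filtration that starts at 0 for γ = 0. By
`tauOp_sub_mem`, τ acts on its graded pieces by the parameters v_j, so τ - v_j maps step j + 1 into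
step j. -/
lemma tauOp_cyclotomic (hcol : Monotone col) (k : ℕ) :
    (List.ofFn fun j : Fin m => tauOp c col v k -
      algebraMap R (Module.End R (Word L →₀ R)) (v j)).prod = 0 := by
  refine end_ext fun x => ?_
  have h := prod_ofFn_apply_mem (fun γ => letterSpan R L (fun a => (col a : ℕ) < γ) 1)
    (fun j : Fin m => tauOp c col v k - algebraMap R (Module.End R (Word L →₀ R)) (v j)) ?_
    (y := wordVec R x) (wordVec_mem_letterSpan (Fin.is_lt _))
  · have h0 : letterSpan R L (fun a => (col a : ℕ) < 0) 1 = ⊥ := by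
      rw [letterSpan, Submodule.span_eq_bot]
      rintro _ ⟨x, hx, _⟩
      exact absurd hx (Nat.not_lt_zero _)
    rw [h0, Submodule.mem_bot] at h
    exact h
  · intro j y hy
    refine map_mem_of_mem_letterSpan _ (fun z hz => ?_) hy
    have e : (tauOp c col v k - algebraMap R (Module.End R (Word L →₀ R)) (v j)) (wordVec R z) =
        (tauOp c col v k (wordVec R z) - v (col (z.letter 1)) • wordVec R z) +
          (v (col (z.letter 1)) - v j) • wordVec R z := by
      rw [LinearMap.sub_apply, Module.algebraMap_end_apply]
      module
    rw [e]
    refine add_mem (Submodule.span_mono ?_ (tauOp_sub_mem c col v hcol k z)) ?_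
    · rintro _ ⟨w, hw, rfl⟩
      exact ⟨w, by omega, rfl⟩
    · rcases Nat.lt_succ_iff_lt_or_eq.1 hz with h | h
      · exact Submodule.smul_mem _ _ (wordVec_mem_letterSpan h)
      · rw [Fin.ext h, sub_self, zero_smul]; exact zero_mem _

/-- The operators on coloured words satisfy the defining relations. -/
theorem heckeSystem_wordOps (hcol : Monotone col) (n : ℕ) :
    HeckeSystem c v n (tauOp c col v (n - 1)) (sigmaOp c : ℕ → Module.End R (Word L →₀ R)) where
  braid i _ _ := (sigmaOp_braid c i).symm
  comm i j _ hij _ := exchangeOp_commute _ _ hij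
  tau_braid hn := by
    obtain ⟨k, hk⟩ : ∃ k, n - 1 = k + 1 := ⟨n - 2, by omega⟩
    rw [hk]; exact tauOp_braid c col v hcol k
  tau_comm i hi hin := tauOp_commute_sigmaOp c col v hcol hi (by omega)
  quadratic i _ _ := sigmaOp_quadratic c i
  cyclotomic _ := tauOp_cyclotomic c col v hcol (n - 1)

end Cyclotomic

/-! ### Change of the base ring -/

section BaseChange

variable {R F : Type*} [CommRing R] [CommRing F] (φ : R →+* F) {L : Type*}

/-- Apply a ring homomorphism to the coefficients of a combination of words. -/
noncomputable def mapCoeff : (Word L →₀ R) →+ (Word L →₀ F) :=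
  Finsupp.mapRange.addMonoidHom φ.toAddMonoidHom

lemma mapCoeff_apply (y : Word L →₀ R) (x : Word L) : mapCoeff φ y x = φ (y x) := rfl

@[simp] lemma mapCoeff_smul (r : R) (y : Word L →₀ R) :
    mapCoeff φ (r • y) = φ r • mapCoeff φ y := by
  ext x; simp [mapCoeff_apply]

@[simp] lemma mapCoeff_wordVec (x : Word L) : mapCoeff φ (wordVec R x) = wordVec F x := by
  simp [mapCoeff, wordVec]

lemma mapCoeff_comm {A : Module.End R (Word L →₀ R)} {B : Module.End F (Word L →₀ F)}
    (h : ∀ x, mapCoeff φ (A (wordVec R x)) = B (wordVec F x)) (y : Word L →₀ R) :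
    mapCoeff φ (A y) = B (mapCoeff φ y) := by
  induction y using Finsupp.induction_linear with
  | zero => simp
  | add y z hy hz => simp only [map_add, hy, hz]
  | single x r =>
    have : Finsupp.single x r = r • wordVec R x := by simp [wordVec]
    rw [this, map_smul, mapCoeff_smul, h, mapCoeff_smul, map_smul, mapCoeff_wordVec]

lemma mapCoeff_exchangeOp {f : L → L → R} {g : L → L → F} (h : ∀ a b, φ (f a b) = g a b) (i : ℕ)
    (y : Word L →₀ R) : mapCoeff φ (exchangeOp f i y) = exchangeOp g i (mapCoeff φ y) :=
  mapCoeff_comm φ (fun x => by simp [h]) y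

lemma mapCoeff_sigmaOp [LinearOrder L] (c : R) (i : ℕ) (y : Word L →₀ R) :
    mapCoeff φ (sigmaOp c i y) = sigmaOp (φ c) i (mapCoeff φ y) :=
  mapCoeff_exchangeOp φ (fun a b => by simp only [sigmaCoeff]; split_ifs <;> simp) i y

lemma mapCoeff_tauOp [LinearOrder L] (c : R) {m : ℕ} (col : L → Fin m) (v : Fin m → R) (k : ℕ)
    (y : Word L →₀ R) :
    mapCoeff φ (tauOp c col v k y) = tauOp (φ c) col (φ ∘ v) k (mapCoeff φ y) := by
  have h1 : ∀ k (y : Word L →₀ R),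
      mapCoeff φ (sigmaInvProd c k y) = sigmaInvProd (φ c) k (mapCoeff φ y) := by
    intro k
    induction k with
    | zero => intro y; rfl
    | succ k ih =>
      intro y
      simp only [sigmaInvProd, Module.End.mul_apply]
      rw [ih, mapCoeff_exchangeOp φ (f := sigmaInvCoeff c) (g := sigmaInvCoeff (φ c)) fun a b => by
        simp only [sigmaInvCoeff]; split_ifs <;> simp]
  have h2 : ∀ k, mapCoeff φ (leftProduct (colourEval col v) (colourOp c col) k y) =
      leftProduct (colourEval col (φ ∘ v)) (colourOp (φ c) col) k (mapCoeff φ y) := by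
    intro k
    induction k with
    | zero =>
      exact mapCoeff_comm φ (A := colourEval col v) (B := colourEval col (φ ∘ v))
        (fun x => by simp) y
    | succ k ih =>
      simp only [leftProduct, Module.End.mul_apply]
      rw [mapCoeff_exchangeOp φ (f := colourCoeff c col) (g := colourCoeff (φ c) col) fun a b => by
        simp only [colourCoeff]; split_ifs <;> simp]
      rw [ih]
  rw [tauOp, Module.End.mul_apply, h1, h2, tauOp, Module.End.mul_apply]

end BaseChange

/-! ### The undeformed operators -/

section Undeformed

variable {F : Type*} [Field F] {L : Type*}

lemma aeval_letterOp (g : L → F) (p : ℕ) (P : Polynomial F) :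
    Polynomial.aeval (letterOp g p) P = letterOp (fun a => P.eval (g a)) p := by
  refine end_ext fun x => ?_
  rw [letterOp_wordVec]
  refine Module.End.aeval_apply_of_hasEigenvector ⟨?_, ?_⟩
  · rw [Module.End.mem_eigenspace_iff, letterOp_wordVec]
  · simp [wordVec]

lemma aeval_mem_of_stable {M : Type*} [AddCommGroup M] [Module F M] {K : Submodule F M}
    {f : Module.End F M} (hf : ∀ y ∈ K, f y ∈ K) (P : Polynomial F) {y : M} (hy : y ∈ K) :
    Polynomial.aeval f P y ∈ K := by
  induction P using Polynomial.induction_on' with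
  | add P Q hP hQ => rw [map_add]; exact add_mem hP hQ
  | monomial k a =>
    rw [Polynomial.aeval_monomial, Module.End.mul_apply, Module.algebraMap_end_apply]
    refine Submodule.smul_mem _ _ ?_
    induction k with
    | zero => exact hy
    | succ k ih => rw [pow_succ', Module.End.mul_apply]; exact hf _ ih

variable [LinearOrder L] {m : ℕ} (col : L → Fin m) (v : Fin m → F)

lemma sigmaOp_zero_wordVec (i : ℕ) (x : Word L) :
    sigmaOp (0 : F) i (wordVec F x) = wordVec F (x.exchange i) := by
  simp [sigmaCoeff]

/-- For c = 0 the operators S_i and σ_i are both plain exchanges, so the products around ϖ cancel.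
-/
lemma tauOp_zero (k : ℕ) : tauOp (0 : F) col v k = colourEval col v := by
  have h : colourOp (0 : F) col = sigmaOp 0 := by
    funext i
    refine end_ext fun x => ?_
    simp [sigmaCoeff, colourCoeff]
  rw [tauOp, leftProduct_eq_mul, h, ← mul_assoc, sigmaInvProd_mul_leftProduct, one_mul]

/-- Conjugation by the exchange at p moves a diagonal operator from position p to position p + 1. -/
lemma letterOp_mem_of_stable {K : Submodule F (Word L →₀ F)} {n : ℕ}
    (hσ : ∀ i, 1 ≤ i → i + 1 ≤ n → ∀ y ∈ K, sigmaOp (0 : F) i y ∈ K) (g : L → F)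
    (hg : 1 ≤ n → ∀ y ∈ K, letterOp g 1 y ∈ K) {p : ℕ} (hp : 1 ≤ p) (hpn : p ≤ n) :
    ∀ y ∈ K, letterOp g p y ∈ K := by
  induction p with
  | zero => omega
  | succ p ih =>
    rcases Nat.eq_zero_or_pos p with rfl | hp'
    · exact hg hpn
    · have e : letterOp g (p + 1) = sigmaOp (0 : F) p * letterOp g p * sigmaOp (0 : F) p := by
        refine end_ext fun x => ?_
        simp [Module.End.mul_apply, sigmaCoeff]
      intro y hy
      rw [e, Module.End.mul_apply, Module.End.mul_apply]
      exact hσ p hp' hpn _ (ih hp' (by omega) _ (hσ p hp' hpn _ hy))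

/-- A space of combinations of words that is stable under the undeformed operators is stable under
the projections to the words with a given colour at a given position. -/
lemma colourProjection_mem (hv : Function.Injective v) {K : Submodule F (Word L →₀ F)} {n : ℕ}
    (hσ : ∀ i, 1 ≤ i → i + 1 ≤ n → ∀ y ∈ K, sigmaOp (0 : F) i y ∈ K)
    (hτ : 1 ≤ n → ∀ y ∈ K, colourEval col v y ∈ K) {p : ℕ} (hp : 1 ≤ p) (hpn : p ≤ n)
    (j : Fin m) {y : Word L →₀ F} (hy : y ∈ K) :
    letterOp (fun a => if col a = j then 1 else 0) p y ∈ K := by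
  -- Since the v_j are distinct, the Lagrange polynomial of the node v_j, evaluated at the diagonal
  -- operator, is the projection to colour j.
  have h := aeval_mem_of_stable (letterOp_mem_of_stable hσ _ hτ hp hpn)
    (Lagrange.basis Finset.univ v j) hy
  rw [aeval_letterOp] at h
  convert h using 4 with a
  split_ifs with ha
  · rw [ha, Lagrange.eval_basis_self hv.injOn (Finset.mem_univ _)]
  · rw [Lagrange.eval_basis_of_ne (Ne.symm ha) (Finset.mem_univ _)]

end Undeformed

/-! ### Linear independence of the standard monomials -/

section ColouredPermutations

/-- The letters: pairs of a colour and a label, ordered lexicographically. -/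
abbrev Letter (m : ℕ) : Type := Fin m ×ₗ ℕ

/-- The colour of a letter. -/
def letterColour {m : ℕ} (a : Letter m) : Fin m := (ofLex a).1

lemma letterColour_mono {m : ℕ} : Monotone (letterColour : Letter m → Fin m) :=
  Prod.Lex.monotone_fst_ofLex

variable {m n : ℕ}

/-- The word with the labels `w 0, w 1, …`, each label `l` having the colour `γ l`. -/
def colouredWord (γ : ℕ → Fin m) (w : Equiv.Perm ℕ) : Word (Letter m) where
  letter p := toLex (γ (w p), w p)
  injective _ _ h := w.injective (congrArg (fun a => (ofLex a).2) h)

lemma colouredWord_exchange (γ : ℕ → Fin m) (w : Equiv.Perm ℕ) (i : ℕ) :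
    (colouredWord γ w).exchange i = colouredWord γ (w * Equiv.swap i (i + 1)) := rfl

/-- The embedding of `Fin n` onto the positions `1, …, n`. -/
def positionEmbedding (n : ℕ) : Fin n ↪ ℕ :=
  ⟨fun i => i + 1, fun _ _ h => Fin.ext (Nat.succ_injective h)⟩

/-- Extend a colouring of `1, …, n` by the first colour. -/
def extendColouring (hm : 1 ≤ m) (γ : Fin n → Fin m) (p : ℕ) : Fin m :=
  if h : 1 ≤ p ∧ p ≤ n then γ ⟨p - 1, by omega⟩ else ⟨0, hm⟩

lemma extendColouring_succ (hm : 1 ≤ m) (γ : Fin n → Fin m) (i : Fin n) :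
    extendColouring hm γ (i + 1) = γ i := by
  rw [extendColouring, dif_pos ⟨by omega, by omega⟩]
  rfl

/-- The word of a coloured permutation of `1, …, n`. -/
noncomputable def permWord (hm : 1 ≤ m) (g : (Fin n → Fin m) × Equiv.Perm (Fin n)) :
    Word (Letter m) :=
  colouredWord (extendColouring hm g.1) (g.2.viaEmbedding (positionEmbedding n))

lemma permWord_injective (hm : 1 ≤ m) :
    Function.Injective (permWord hm : (Fin n → Fin m) × Equiv.Perm (Fin n) → _) := by
  rintro ⟨γ, w⟩ ⟨γ', w'⟩ h
  have h2 : ∀ p, w.viaEmbedding (positionEmbedding n) p =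
      w'.viaEmbedding (positionEmbedding n) p :=
    fun p => congrArg (fun x : Word (Letter m) => (ofLex (x.letter p)).2) h
  obtain rfl : w = w' :=
    Equiv.Perm.viaEmbeddingHom_injective (positionEmbedding n) (Equiv.ext h2)
  refine Prod.ext (funext fun i => ?_) rfl
  -- The label i + 1 stands at the position that corresponds to w⁻¹ i, and its colour there is γ i.
  have h1 := congrArg (fun x : Word (Letter m) =>
    (ofLex (x.letter (positionEmbedding n (w.symm i)))).1) h
  simp only [permWord, colouredWord, ofLex_toLex, Equiv.Perm.viaEmbedding_apply,
    Equiv.apply_symm_apply] at h1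
  change γ i = γ' i
  rw [← extendColouring_succ hm γ, ← extendColouring_succ hm γ']
  exact h1

lemma permWord_exchange (hm : 1 ≤ m) (γ : Fin (n + 1) → Fin m) (w : Equiv.Perm (Fin (n + 1)))
    (i : Fin n) : (permWord hm (γ, w)).exchange (i + 1) =
      permWord hm (γ, w * Equiv.swap i.castSucc i.succ) := by
  have e : (Equiv.swap i.castSucc i.succ).viaEmbedding (positionEmbedding (n + 1)) =
      Equiv.swap ((i : ℕ) + 1) (i + 1 + 1) := by
    ext p
    by_cases hp : p ∈ Set.range (positionEmbedding (n + 1))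
    · obtain ⟨j, rfl⟩ := hp
      rw [Equiv.Perm.viaEmbedding_apply]
      exact ((positionEmbedding (n + 1)).swap_apply _ _ _).symm
    · rw [Equiv.Perm.viaEmbedding_apply_of_notMem _ _ _ hp, Equiv.swap_apply_of_ne_of_ne]
      · rintro rfl; exact hp ⟨i.castSucc, rfl⟩
      · rintro rfl; exact hp ⟨i.succ, rfl⟩
  rw [permWord, permWord, colouredWord_exchange, ← e]
  congr 1
  exact ((Equiv.Perm.viaEmbeddingHom (positionEmbedding (n + 1))).map_mul _ _).symm

variable {F : Type*} [Field F]

/-- The sum of the words with the labels in increasing order, over all colourings. -/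
noncomputable def cyclicVector (R : Type*) [CommRing R] (hm : 1 ≤ m) (n : ℕ) :
    Word (Letter m) →₀ R :=
  ∑ γ : Fin n → Fin m, wordVec R (permWord hm (γ, 1))

/-- The vector `cyclicVector` is cyclic for the undeformed operators. -/
lemma wordVec_permWord_mem (hm : 1 ≤ m) {v : Fin m → F} (hv : Function.Injective v)
    {K : Submodule F (Word (Letter m) →₀ F)}
    (hσ : ∀ i, 1 ≤ i → i + 1 ≤ n → ∀ y ∈ K, sigmaOp (0 : F) i y ∈ K)
    (hτ : 1 ≤ n → ∀ y ∈ K, colourEval letterColour v y ∈ K)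
    (hu : cyclicVector F hm n ∈ K) (g : (Fin n → Fin m) × Equiv.Perm (Fin n)) :
    wordVec F (permWord hm g) ∈ K := by
  obtain ⟨γ, w⟩ := g
  have hone : wordVec F (permWord hm (γ, 1)) ∈ K := by
    -- Projecting positions 1, …, k to the colours of γ keeps the colourings that agree with γ on
    -- the first k labels. For k = n one word remains.
    have key : ∀ k ≤ n, (∑ γ' : Fin n → Fin m,
        (if ∀ i : Fin n, (i : ℕ) < k → γ' i = γ i then (1 : F) else 0) •
          wordVec F (permWord hm (γ', 1))) ∈ K := by
      intro k hk
      induction k with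
      | zero => simpa [cyclicVector] using hu
      | succ k ih =>
        have h := colourProjection_mem letterColour v hv hσ hτ (p := k + 1) (by omega) hk
          (γ ⟨k, hk⟩) (ih (by omega))
        rw [map_sum] at h
        convert h using 2 with γ'
        have hcol : letterColour ((permWord hm (γ', 1)).letter (k + 1)) = γ' ⟨k, hk⟩ := by
          have : (1 : Equiv.Perm (Fin n)).viaEmbedding (positionEmbedding n) = 1 :=
            (Equiv.Perm.viaEmbeddingHom (positionEmbedding n)).map_one
          simp only [permWord, colouredWord, this, letterColour, ofLex_toLex]
          exact extendColouring_succ hm γ' ⟨k, hk⟩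
        rw [map_smul, letterOp_wordVec, hcol, smul_smul]
        congr 1
        have hiff : (∀ i : Fin n, (i : ℕ) < k + 1 → γ' i = γ i) ↔
            (∀ i : Fin n, (i : ℕ) < k → γ' i = γ i) ∧ γ' ⟨k, hk⟩ = γ ⟨k, hk⟩ := by
          constructor
          · exact fun h => ⟨fun i hi => h i (by omega), h _ (Nat.lt_succ_self k)⟩
          · rintro ⟨h1, h2⟩ i hi
            rcases Nat.lt_succ_iff_lt_or_eq.1 hi with hi | hi
            · exact h1 i hi
            · obtain rfl : i = ⟨k, hk⟩ := Fin.ext hi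
              exact h2
        rw [if_congr hiff rfl rfl, ite_and]
        split_ifs <;> simp
    have h := key n le_rfl
    rw [Finset.sum_eq_single γ] at h
    · simpa using h
    · intro γ' _ hne
      rw [if_neg, zero_smul]
      exact fun hall => hne (funext fun i => hall i i.2)
    · simp
  rcases n with _ | n
  · rwa [Subsingleton.elim w 1]
  -- Adjacent transpositions generate the symmetric group as a monoid, and right multiplication by
  -- one of them is an exchange of neighbouring positions.
  · have hw : w ∈ Submonoid.closure (Set.range fun i : Fin n => Equiv.swap i.castSucc i.succ) := by
      rw [Equiv.Perm.mclosure_swap_castSucc_succ]; trivial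
    induction hw using Submonoid.closure_induction_right with
    | one => exact hone
    | mul_right w _ y hy ih =>
      obtain ⟨i, rfl⟩ := hy
      have := hσ (i + 1) (by omega) (by omega) _ ih
      rwa [sigmaOp_zero_wordVec, permWord_exchange] at this

end ColouredPermutations

section Independence

/-- A square matrix over a domain has independent rows if the rows of its image under a
homomorphism to a field span. -/
lemma linearIndependent_of_span_map_eq_top {R F ι κ : Type*} [CommRing R] [IsDomain R] [Field F]
    (φ : R →+* F) [Fintype ι] [Fintype κ] (hcard : Fintype.card ι = Fintype.card κ)
    (A : ι → κ → R) (hA : ⊤ ≤ Submodule.span F (Set.range fun i k => φ (A i k))) :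
    LinearIndependent R A := by
  classical
  let e : κ ≃ ι := Fintype.equivOfCardEq hcard.symm
  have hF : LinearIndependent F fun i k => φ (A i k) :=
    linearIndependent_of_top_le_span_of_card_eq_finrank hA (by
      rw [Module.finrank_fintype_fun_eq_card, hcard])
  let B : Matrix κ κ R := Matrix.of fun i k => A (e i) k
  have hB : IsUnit (B.map φ) := by
    rw [← Matrix.linearIndependent_rows_iff_isUnit]
    exact hF.comp e e.injective
  have hdet : B.det ≠ 0 := by
    intro h0
    rw [Matrix.isUnit_iff_isUnit_det] at hB
    have : (B.map φ).det = φ B.det := (RingHom.map_det φ B).symm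
    rw [this, h0, map_zero] at hB
    exact not_isUnit_zero hB
  have := Matrix.linearIndependent_rows_of_det_ne_zero hdet
  exact (linearIndependent_equiv e).1 this

/-- A spanning family of `n! m^n` elements of an algebra that acts on coloured words through the
operators above is linearly independent, if the parameters can be specialized to `c = 0` and
pairwise distinct `v_1, …, v_m`. -/
theorem linearIndependent_of_wordOps {R F H ι : Type*} [CommRing R] [IsDomain R] [Field F]
    [Ring H] [Algebra R H] (φ : R →+* F) {m n : ℕ} (hm : 1 ≤ m) {c : R} {v : Fin m → R}
    (hc : φ c = 0) (hv : Function.Injective (φ ∘ v)) {t : H} {s : ℕ → H}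
    (ρ : H →ₐ[R] Module.End R (Word (Letter m) →₀ R))
    (hρt : 1 ≤ n → ρ t = tauOp c letterColour v (n - 1))
    (hρs : ∀ i, 1 ≤ i → i + 1 ≤ n → ρ (s i) = sigmaOp c i)
    [Fintype ι] (hι : Fintype.card ι = n.factorial * m ^ n) (b : ι → H)
    (hb : ⊤ ≤ Submodule.span R (Set.range b)) : LinearIndependent R b := by
  let orbit : H →ₗ[R] (Word (Letter m) →₀ R) :=
    (LinearMap.applyₗ (cyclicVector R hm n)).comp ρ.toLinearMap
  have horbit : ∀ x y, orbit (x * y) = ρ x (orbit y) := fun x y => by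
    simp [orbit, Module.End.mul_apply]
  let K : Submodule F (Word (Letter m) →₀ F) :=
    Submodule.span F (Set.range fun h => mapCoeff φ (orbit h))
  -- K is stable under every operator over F that is the specialization of some ρ(x). This supplies
  -- the stability hypotheses of `wordVec_permWord_mem`.
  have hK : ∀ (x : H) (B : Module.End F (Word (Letter m) →₀ F)),
      (∀ y, mapCoeff φ (ρ x y) = B (mapCoeff φ y)) → ∀ y ∈ K, B y ∈ K := by
    intro x B hB y hy
    induction hy using Submodule.span_induction with
    | mem y hy =>
      obtain ⟨h, rfl⟩ := hy
      exact Submodule.subset_span ⟨x * h, by simp only [horbit, hB]⟩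
    | zero => simp
    | add y z _ _ hy hz => rw [map_add]; exact add_mem hy hz
    | smul r y _ hy => rw [map_smul]; exact Submodule.smul_mem _ _ hy
  have hmem : ∀ g : (Fin n → Fin m) × Equiv.Perm (Fin n), wordVec F (permWord hm g) ∈ K := by
    refine wordVec_permWord_mem hm hv ?_ ?_ ?_
    · intro i h1 h2
      refine hK (s i) _ fun y => ?_
      rw [hρs i h1 h2, mapCoeff_sigmaOp, hc]
    · intro hn
      refine hK t _ fun y => ?_
      rw [hρt hn, mapCoeff_tauOp, hc, tauOp_zero]
    · refine Submodule.subset_span ⟨1, ?_⟩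
      simp [orbit, cyclicVector]
  have hKb : K ≤ Submodule.span F (Set.range fun i => mapCoeff φ (orbit (b i))) := by
    refine Submodule.span_le.2 ?_
    rintro _ ⟨h, rfl⟩
    have hh := hb (Submodule.mem_top : h ∈ ⊤)
    induction hh using Submodule.span_induction with
    | mem x hx => obtain ⟨i, rfl⟩ := hx; exact Submodule.subset_span ⟨i, rfl⟩
    | zero => simp
    | add y z _ _ hy hz => simp only [map_add]; exact add_mem hy hz
    | smul r y _ hy =>
      simp only [map_smul, mapCoeff_smul]; exact Submodule.smul_mem _ _ hy
  -- Restriction to the coordinates of the coloured permutations gives a square matrix with n! m^n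
  -- rows.
  let res : (Word (Letter m) →₀ R) →ₗ[R] ((Fin n → Fin m) × Equiv.Perm (Fin n) → R) :=
    LinearMap.pi fun g => Finsupp.lapply (permWord hm g)
  let resF : (Word (Letter m) →₀ F) →ₗ[F] ((Fin n → Fin m) × Equiv.Perm (Fin n) → F) :=
    LinearMap.pi fun g => Finsupp.lapply (permWord hm g)
  refine LinearIndependent.of_comp (res.comp orbit) ?_
  refine linearIndependent_of_span_map_eq_top φ ?_ _ ?_
  · rw [hι, Fintype.card_prod, Fintype.card_fun, Fintype.card_perm, Fintype.card_fin,
      Fintype.card_fin, mul_comm]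
  · have hrange : (Set.range fun i k => φ ((⇑(res.comp orbit) ∘ b) i k)) =
        resF '' Set.range fun i => mapCoeff φ (orbit (b i)) := by
      rw [← Set.range_comp]
      rfl
    rw [hrange, Submodule.span_image, ← (Pi.basisFun F _).span_eq, Submodule.span_le]
    rintro _ ⟨g, rfl⟩
    refine ⟨wordVec F (permWord hm g), hKb (hmem g), ?_⟩
    ext g'
    rw [Pi.basisFun_apply]
    change (Finsupp.single (permWord hm g) (1 : F)) (permWord hm g') = _
    by_cases h : g' = g
    · rw [h, Finsupp.single_eq_same, Pi.single_eq_same]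
    · rw [Pi.single_eq_of_ne h, Finsupp.single_eq_of_ne ((permWord_injective hm).ne h)]

end Independence

/-! ### The universal property and the standard basis -/

section Presentation

lemma HeckeSystem.mono {R H : Type*} [CommRing R] [Ring H] [Algebra R H] {c : R} {m : ℕ}
    {v : Fin m → R} {n k : ℕ} {t : H} {s : ℕ → H} (h : HeckeSystem c v n t s) (hkn : k ≤ n) :
    HeckeSystem c v k t s where
  braid i h1 h2 := h.braid i h1 (h2.trans hkn)
  comm i j h1 h2 h3 := h.comm i j h1 h2 (h3.trans hkn)
  tau_braid h1 := h.tau_braid (h1.trans hkn)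
  tau_comm i h1 h2 := h.tau_comm i h1 (h2.trans hkn)
  quadratic i h1 h2 := h.quadratic i h1 (h2.trans hkn)
  cyclotomic h1 := h.cyclotomic (h1.trans hkn)

lemma HeckeSystem.of_algebraMap {R F H : Type*} [CommRing R] [CommRing F] [Ring H] [Algebra R F]
    [Algebra F H] [Algebra R H] [IsScalarTower R F H] {c : R} {m : ℕ} {v : Fin m → R} {n : ℕ}
    {t : H} {s : ℕ → H}
    (h : HeckeSystem (algebraMap R F c) (fun j => algebraMap R F (v j)) n t s) :
    HeckeSystem c v n t s where
  braid := h.braid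
  comm := h.comm
  tau_braid := h.tau_braid
  tau_comm := h.tau_comm
  quadratic i h1 h2 := by rw [h.quadratic i h1 h2, algebraMap_smul]
  cyclotomic h1 := by
    have := h.cyclotomic h1
    simpa only [← IsScalarTower.algebraMap_apply R F H] using this

variable {A : Type} [CommRing A] {m : ℕ} {q : Aˣ} {v : Fin m → A} {n : ℕ}

/-- The images of the generators under a homomorphism. -/
def genImage {B : Type*} (t : B) (s : ℕ → B) : HeckeGen n → B
  | .tau _ => t
  | .sigma i _ _ => s i

/-- The homomorphism determined by the images of the generators. -/
def liftHom {B : Type*} [Ring B] [Algebra A B] {t : B} {s : ℕ → B}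
    (h : HeckeSystem ((q : A) - ((q⁻¹ : Aˣ) : A)) v n t s) : CyclotomicHecke q v n →ₐ[A] B :=
  RingQuot.liftAlgHom A ⟨FreeAlgebra.lift A (genImage t s), by
    have ht : ∀ h, FreeAlgebra.lift A (genImage t s) (freeTau n h) = t :=
      fun h => FreeAlgebra.lift_ι_apply _ _
    have hs : ∀ i h₁ h₂, FreeAlgebra.lift A (genImage t s) (freeSigma n i h₁ h₂) = s i :=
      fun i h₁ h₂ => FreeAlgebra.lift_ι_apply _ _
    intro x y hxy
    cases hxy with
    | braid i h₁ h₂ h₃ h₄ => simpa only [map_mul, hs] using h.braid i h₁ h₄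
    | comm i j h₁ h₂ h₃ h₄ hij =>
      simpa only [map_mul, hs] using (h.commute_s h₁ h₂ h₃ h₄ hij).eq
    | tau_braid h' h₁ h₂ => simpa only [map_mul, hs, ht] using h.tau_braid h₂
    | tau_comm h' i h₁ h₂ hi => simpa only [map_mul, hs, ht] using (h.tau_comm i hi h₂).eq
    | quadratic i h₁ h₂ =>
      simpa only [pow_two, map_mul, map_add, map_smul, map_one, hs] using h.quadratic i h₁ h₂
    | cyclotomic h' =>
      simpa only [map_list_prod, List.map_ofFn, Function.comp_def, map_sub, ht, AlgHom.commutes,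
        map_zero] using h.cyclotomic h'⟩

lemma liftHom_tau {B : Type*} [Ring B] [Algebra A B] {t : B} {s : ℕ → B}
    (h : HeckeSystem ((q : A) - ((q⁻¹ : Aˣ) : A)) v n t s) (hn : 1 ≤ n) :
    liftHom h (tau q v n hn) = t :=
  (RingQuot.liftAlgHom_mkAlgHom_apply A _ _ _).trans (FreeAlgebra.lift_ι_apply _ _)

lemma liftHom_sigma {B : Type*} [Ring B] [Algebra A B] {t : B} {s : ℕ → B}
    (h : HeckeSystem ((q : A) - ((q⁻¹ : Aˣ) : A)) v n t s) (i : ℕ) (h₁ : 1 ≤ i) (h₂ : i + 1 ≤ n) :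
    liftHom h (sigma q v n i h₁ h₂) = s i :=
  (RingQuot.liftAlgHom_mkAlgHom_apply A _ _ _).trans (FreeAlgebra.lift_ι_apply _ _)

variable (q v n)

/-- The generator `τ`, or `0` if there is none. -/
def genTau : CyclotomicHecke q v n := if h : 1 ≤ n then tau q v n h else 0

/-- The generator `σ_i`, or `0` if there is none. -/
def genSigma (i : ℕ) : CyclotomicHecke q v n :=
  if h : 1 ≤ i ∧ i + 1 ≤ n then sigma q v n i h.1 h.2 else 0

variable {n} in
lemma genTau_eq (h : 1 ≤ n) : genTau q v n = tau q v n h := dif_pos h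

variable {n} in
lemma genSigma_eq {i : ℕ} (h₁ : 1 ≤ i) (h₂ : i + 1 ≤ n) :
    genSigma q v n i = sigma q v n i h₁ h₂ := dif_pos ⟨h₁, h₂⟩

/-- The canonical map from the free algebra. -/
def mkHom : FreeAlgebra A (HeckeGen n) →ₐ[A] CyclotomicHecke q v n :=
  RingQuot.mkAlgHom A (Rel q v n)

variable {n} in
lemma mkHom_rel {x y : FreeAlgebra A (HeckeGen n)} (h : Rel q v n x y) :
    mkHom q v n x = mkHom q v n y :=
  RingQuot.mkAlgHom_rel A h

lemma mkHom_freeTau (h : 1 ≤ n) : mkHom q v n (freeTau n h) = tau q v n h := rfl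

lemma mkHom_freeSigma (i : ℕ) (h₁ : 1 ≤ i) (h₂ : i + 1 ≤ n) :
    mkHom q v n (freeSigma n i h₁ h₂) = sigma q v n i h₁ h₂ := rfl

lemma heckeSystem_gen :
    HeckeSystem ((q : A) - ((q⁻¹ : Aˣ) : A)) v n (genTau q v n) (genSigma q v n) where
  braid i h₁ h₂ := by
    rw [genSigma_eq q v h₁ (by omega), genSigma_eq q v (show 1 ≤ i + 1 by omega) (by omega)]
    have := mkHom_rel q v
      (Rel.braid i h₁ (by omega) (by omega) h₂)
    simpa only [map_mul, mkHom_freeTau, mkHom_freeSigma] using this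
  comm i j h₁ h₂ h₃ := by
    rw [commute_iff_eq]
    rw [genSigma_eq q v h₁ (by omega), genSigma_eq q v (show 1 ≤ j by omega) (by omega)]
    have := mkHom_rel q v
      (Rel.comm i j h₁ (by omega) (by omega) h₃ (Or.inl h₂))
    simpa only [map_mul, mkHom_freeTau, mkHom_freeSigma] using this
  tau_braid h := by
    rw [genSigma_eq q v le_rfl h, genTau_eq q v (by omega)]
    have := mkHom_rel q v
      (Rel.tau_braid (by omega) le_rfl h)
    simpa only [map_mul, mkHom_freeTau, mkHom_freeSigma] using this
  tau_comm i h₁ h₂ := by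
    rw [commute_iff_eq]
    rw [genSigma_eq q v (show 1 ≤ i by omega) h₂, genTau_eq q v (by omega)]
    have := mkHom_rel q v
      (Rel.tau_comm (by omega) i (by omega) h₂ h₁)
    simpa only [map_mul, mkHom_freeTau, mkHom_freeSigma] using this
  quadratic i h₁ h₂ := by
    rw [genSigma_eq q v h₁ h₂]
    have := mkHom_rel q v (Rel.quadratic i h₁ h₂)
    simpa only [pow_two, map_mul, map_add, map_smul, map_one, mkHom_freeSigma] using this
  cyclotomic h := by
    rw [genTau_eq q v h]
    have := mkHom_rel q v (Rel.cyclotomic h)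
    simpa only [map_list_prod, List.map_ofFn, Function.comp_def, map_sub, AlgHom.commutes,
      map_zero, mkHom_freeTau] using this

lemma parabolic_gen : parabolic A (genTau q v n) (genSigma q v n) n = ⊤ := by
  refine eq_top_iff.2 fun x _ => ?_
  obtain ⟨x, rfl⟩ : ∃ y, mkHom q v n y = x := RingQuot.mkAlgHom_surjective A (Rel q v n) x
  clear * -
  induction x using FreeAlgebra.induction with
  | grade0 r => rw [AlgHom.commutes]; exact Subalgebra.algebraMap_mem _ r
  | grade1 g =>
    cases g with
    | tau h =>
      have : genTau q v n ∈ parabolic A (genTau q v n) (genSigma q v n) n := t_mem_parabolic _ _ h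
      convert this using 1
      exact (genTau_eq q v h).symm
    | sigma i h₁ h₂ =>
      have : genSigma q v n i ∈ parabolic A (genTau q v n) (genSigma q v n) n :=
        s_mem_parabolic _ _ h₁ h₂
      convert this using 1
      exact (genSigma_eq q v h₁ h₂).symm
  | mul x y hx hy => rw [map_mul]; exact mul_mem hx hy
  | add x y hx hy => rw [map_add]; exact add_mem hx hy

lemma top_le_span_standardMonomial (hm : 1 ≤ m) :
    ⊤ ≤ Submodule.span A (Set.range (standardMonomial (genTau q v n) (genSigma q v n) m n)) := by
  have := (heckeSystem_gen q v n).parabolic_le_span_standardMonomial hm le_rfl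
  rwa [parabolic_gen, Algebra.top_toSubmodule] at this

/-- The standard monomials are linearly independent if the parameters specialize to `q = q⁻¹` and
pairwise distinct `v_1, …, v_m` in some field. -/
theorem linearIndependent_standardMonomial [IsDomain A] {F : Type*} [Field F] (φ : A →+* F)
    (hm : 1 ≤ m) (hq : φ ((q : A) - ((q⁻¹ : Aˣ) : A)) = 0) (hv : Function.Injective (φ ∘ v)) :
    LinearIndependent A (standardMonomial (genTau q v n) (genSigma q v n) m n) := by
  refine linearIndependent_of_wordOps φ hm (n := n) (t := genTau q v n) (s := genSigma q v n)
    hq hv (liftHom (heckeSystem_wordOps _ letterColour v letterColour_mono n)) ?_ ?_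
    (card_monomialIndex m n) _ (top_le_span_standardMonomial q v n hm)
  · intro h
    rw [genTau_eq q v h, liftHom_tau]
  · intro i h₁ h₂
    rw [genSigma_eq q v h₁ h₂, liftHom_sigma]

/-- The standard basis. -/
noncomputable def standardBasis [IsDomain A] {F : Type*} [Field F] (φ : A →+* F)
    (hm : 1 ≤ m) (hq : φ ((q : A) - ((q⁻¹ : Aˣ) : A)) = 0) (hv : Function.Injective (φ ∘ v)) :
    Module.Basis (MonomialIndex m n) A (CyclotomicHecke q v n) :=
  Module.Basis.mk (linearIndependent_standardMonomial q v n φ hm hq hv)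
    (top_le_span_standardMonomial q v n hm)

/-- The homomorphism from the algebra of level `n - 1` to the one of level `n`. -/
def inclusionHom : CyclotomicHecke q v (n - 1) →ₐ[A] CyclotomicHecke q v n :=
  liftHom ((heckeSystem_gen q v n).mono (Nat.sub_le n 1))

lemma inclusionHom_tau (h : 1 ≤ n - 1) :
    inclusionHom q v n (tau q v (n - 1) h) = tau q v n (by omega) := by
  rw [inclusionHom, liftHom_tau, genTau_eq]

lemma inclusionHom_sigma (i : ℕ) (h₁ : 1 ≤ i) (h₂ : i + 1 ≤ n - 1) :
    inclusionHom q v n (sigma q v (n - 1) i h₁ h₂) = sigma q v n i h₁ (by omega) := by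
  rw [inclusionHom, liftHom_sigma, genSigma_eq]

lemma inclusionHom_range : (inclusionHom q v n).range = subW q v n := by
  apply le_antisymm
  · rw [← Algebra.map_top, ← parabolic_gen, parabolic, AlgHom.map_adjoin]
    refine Algebra.adjoin_mono ?_
    rintro _ ⟨x, ⟨h, rfl⟩ | ⟨i, h₁, h₂, rfl⟩, rfl⟩
    · exact Or.inl ⟨by omega, by rw [genTau_eq q v h, inclusionHom_tau]⟩
    · exact Or.inr ⟨i, h₁, by omega, by rw [genSigma_eq q v h₁ h₂, inclusionHom_sigma]⟩
  · refine Algebra.adjoin_le ?_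
    rintro x (⟨h, rfl⟩ | ⟨i, h₁, h₂, rfl⟩)
    · exact ⟨_, inclusionHom_tau q v n (by omega)⟩
    · exact ⟨_, inclusionHom_sigma q v n i h₁ (by omega)⟩

/-- The spanning monomials of level n go to standard monomials of level n + 1 with trivial last
factor (a = 0, j = 0), and these are independent. -/
lemma inclusionHom_injective [IsDomain A] {F : Type*} [Field F] (φ : A →+* F)
    (hm : 1 ≤ m) (hq : φ ((q : A) - ((q⁻¹ : Aˣ) : A)) = 0) (hv : Function.Injective (φ ∘ v)) :
    Function.Injective (inclusionHom q v (n + 1)) := by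
  have hli : LinearIndependent A
      (standardMonomial (genTau q v (n + 1)) (genSigma q v (n + 1)) m n) := by
    have h := linearIndependent_standardMonomial q v (n + 1) φ hm hq hv
    have hinj : Function.Injective
        (fun i : MonomialIndex m n => ((i, ⟨0, hm⟩, 0) : MonomialIndex m (n + 1))) :=
      fun i j hij => congrArg Prod.fst hij
    convert h.comp _ hinj using 1
    funext i
    change _ = standardMonomial (genTau q v (n + 1)) (genSigma q v (n + 1)) m n i * _ ^ 0 * 1
    rw [pow_zero, mul_one, mul_one]
  rw [injective_iff_map_eq_zero]
  intro x hx
  obtain ⟨r, rfl⟩ := (Submodule.mem_span_range_iff_exists_fun A).1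
    (top_le_span_standardMonomial q v n hm (Submodule.mem_top : x ∈ ⊤))
  have hmap : ∀ i, inclusionHom q v (n + 1)
      (standardMonomial (genTau q v n) (genSigma q v n) m n i) =
        standardMonomial (genTau q v (n + 1)) (genSigma q v (n + 1)) m n i := fun i =>
    map_standardMonomial (inclusionHom q v (n + 1)).toRingHom _ _ _ _ m n
      (fun h => by
        rw [genTau_eq q v h, genTau_eq q v (Nat.le_succ_of_le h)]
        exact inclusionHom_tau q v (n + 1) h)
      (fun i h₁ h₂ => by
        rw [genSigma_eq q v h₁ h₂, genSigma_eq q v h₁ (Nat.le_succ_of_le h₂)]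
        exact inclusionHom_sigma q v (n + 1) i h₁ h₂) i
  rw [map_sum] at hx
  have hx' : ∑ i, r i • standardMonomial (genTau q v (n + 1)) (genSigma q v (n + 1)) m n i = 0 := by
    rw [← hx]
    exact Finset.sum_congr rfl fun i _ => by rw [map_smul]; exact congrArg _ (hmap i).symm
  have hr := Fintype.linearIndependent_iff.1 hli r hx'
  exact Finset.sum_eq_zero fun i _ => by rw [hr i, zero_smul]

end Presentation

end CyclotomicHecke

/-! ### The reflection group -/

namespace reflectionGroup

variable {m n : ℕ}

/-- The monomial matrix with the entries `z` and the permutation `π`. -/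
def monomialMatrix (z : Fin n → rootsOfUnity m ℂ) (π : Equiv.Perm (Fin n)) :
    Matrix (Fin n) (Fin n) ℂ :=
  Matrix.of fun i j => if i = π j then ((z i : ℂˣ) : ℂ) else 0

lemma monomialMatrix_mul (z w : Fin n → rootsOfUnity m ℂ) (π ρ : Equiv.Perm (Fin n)) :
    monomialMatrix z π * monomialMatrix w ρ =
      monomialMatrix (fun i => z i * w (π⁻¹ i)) (π * ρ) := by
  ext i j
  rw [Matrix.mul_apply, Finset.sum_eq_single (ρ j)]
  · simp only [monomialMatrix, Matrix.of_apply]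
    by_cases hi : i = π (ρ j)
    · subst hi; simp
    · simp [hi]
  · intro k _ hk
    simp [monomialMatrix, hk]
  · simp

lemma monomialMatrix_one : monomialMatrix (1 : Fin n → rootsOfUnity m ℂ) 1 = 1 := by
  ext i j
  rw [Matrix.one_apply]
  change (if i = j then ((1 : ℂˣ) : ℂ) else 0) = _
  split_ifs <;> rfl

/-- The element of the reflection group with the entries `z` and the permutation `π`. -/
def monomial (z : Fin n → rootsOfUnity m ℂ) (π : Equiv.Perm (Fin n)) : reflectionGroup m n :=
  ⟨⟨monomialMatrix z π, monomialMatrix (fun i => (z (π i))⁻¹) π⁻¹,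
    by rw [monomialMatrix_mul, ← monomialMatrix_one]; congr 1
       · funext i; simp
       · simp,
    by rw [monomialMatrix_mul, ← monomialMatrix_one]; congr 1
       · funext i; simp
       · simp⟩,
    z, π, fun _ _ => rfl⟩

lemma monomial_mul (z w : Fin n → rootsOfUnity m ℂ) (π ρ : Equiv.Perm (Fin n)) :
    monomial z π * monomial w ρ = monomial (fun i => z i * w (π⁻¹ i)) (π * ρ) :=
  Subtype.ext (Units.ext (monomialMatrix_mul z w π ρ))

lemma monomial_one : monomial (1 : Fin n → rootsOfUnity m ℂ) 1 = 1 :=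
  Subtype.ext (Units.ext monomialMatrix_one)

lemma monomial_bijective : Function.Bijective
    fun p : (Fin n → rootsOfUnity m ℂ) × Equiv.Perm (Fin n) => monomial p.1 p.2 := by
  constructor
  · rintro ⟨z, π⟩ ⟨w, ρ⟩ h
    have hM : ∀ i j, (if i = π j then ((z i : ℂˣ) : ℂ) else 0) =
        if i = ρ j then ((w i : ℂˣ) : ℂ) else 0 := fun i j =>
      congrArg (fun g : reflectionGroup m n => (g : GL (Fin n) ℂ).val i j) h
    obtain rfl : π = ρ := by
      ext j
      by_contra hne
      have := hM (π j) j
      rw [if_pos rfl, if_neg fun h => hne (congrArg Fin.val h)] at this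
      exact Units.ne_zero _ this
    refine Prod.ext (funext fun i => ?_) rfl
    have := hM i (π.symm i)
    simp only [Equiv.apply_symm_apply, if_true] at this
    exact Subtype.ext (Units.ext this)
  · rintro ⟨g, z, π, hg⟩
    exact ⟨(z, π), Subtype.ext (Units.ext (Matrix.ext fun i j => (hg i j).symm))⟩

lemma card_eq (hm : 1 ≤ m) : Nat.card (reflectionGroup m n) = n.factorial * m ^ n := by
  have : NeZero m := ⟨by omega⟩
  rw [← Nat.card_congr (Equiv.ofBijective _ (monomial_bijective (m := m) (n := n))), Nat.card_prod,
    Nat.card_fun, Complex.card_rootsOfUnity, Nat.card_eq_fintype_card (α := Fin n),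
    Fintype.card_fin, Nat.card_eq_fintype_card, Fintype.card_perm, Fintype.card_fin, mul_comm]

/-- The diagonal elements. -/
def diagonal : (Fin n → rootsOfUnity m ℂ) →* reflectionGroup m n where
  toFun z := monomial z 1
  map_one' := monomial_one
  map_mul' z w := by rw [monomial_mul]; congr 1

/-- The permutation matrices. -/
def permutation : Equiv.Perm (Fin n) →* reflectionGroup m n where
  toFun π := monomial 1 π
  map_one' := monomial_one
  map_mul' π ρ := by rw [monomial_mul]; congr 1; funext i; simp

lemma diagonal_mul_permutation (z : Fin n → rootsOfUnity m ℂ) (π : Equiv.Perm (Fin n)) :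
    diagonal z * permutation π = monomial z π := by
  change monomial z 1 * monomial 1 π = _
  rw [monomial_mul]
  congr 1
  funext i; simp

lemma permutation_mul_diagonal (z : Fin n → rootsOfUnity m ℂ) (π : Equiv.Perm (Fin n)) :
    permutation π * diagonal z = diagonal (fun i => z (π⁻¹ i)) * permutation π := by
  rw [diagonal_mul_permutation]
  change monomial 1 π * monomial z 1 = _
  rw [monomial_mul]
  congr 1
  funext i; simp

/-- A submonoid that contains the permutations and the elements `diag(z, 1, …, 1)` is everything. -/
lemma eq_top_of_mem {Γ : Submonoid (reflectionGroup m (n + 1))}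
    (hperm : ∀ i : Fin n, permutation (Equiv.swap i.castSucc i.succ) ∈ Γ)
    (hdiag : ∀ z, diagonal (Pi.mulSingle 0 z) ∈ Γ) : Γ = ⊤ := by
  have hperm' : ∀ π, permutation π ∈ Γ := by
    have : Submonoid.closure (Set.range fun i : Fin n => Equiv.swap i.castSucc i.succ) ≤
        Γ.comap permutation := by
      rw [Submonoid.closure_le]
      rintro _ ⟨i, rfl⟩
      exact hperm i
    rw [Equiv.Perm.mclosure_swap_castSucc_succ] at this
    exact fun π => this trivial
  have hdiag' : ∀ i z, diagonal (Pi.mulSingle i z) ∈ Γ := by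
    -- The diagonal element with z in place i is conjugate to the one with z in place 0 by the
    -- transposition of 0 and i.
    intro i z
    have e : diagonal (m := m) (Pi.mulSingle i z) = permutation (Equiv.swap 0 i) *
        diagonal (Pi.mulSingle 0 z) * permutation (Equiv.swap 0 i) := by
      rw [permutation_mul_diagonal, mul_assoc, ← map_mul, Equiv.swap_mul_self, map_one, mul_one]
      congr 1
      funext j
      simp only [Pi.mulSingle_apply, Equiv.swap_inv]
      congr 1
      rw [eq_iff_iff, Equiv.swap_apply_eq_iff, Equiv.swap_apply_left]
    rw [e]
    exact mul_mem (mul_mem (hperm' _) (hdiag z)) (hperm' _)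
  refine eq_top_iff.2 fun g _ => ?_
  obtain ⟨⟨z, π⟩, rfl⟩ := monomial_bijective.surjective g
  change monomial z π ∈ Γ
  have hz : ∏ i, Pi.mulSingle i (z i) ∈ Γ.comap diagonal :=
    Submonoid.prod_mem _ fun i _ => hdiag' i (z i)
  rw [Finset.univ_prod_mulSingle] at hz
  rw [← diagonal_mul_permutation]
  exact mul_mem hz (hperm' π)

/-! ### The relations in the group algebra -/

open CyclotomicHecke

variable (m n : ℕ)

/-- The adjacent transposition of `i - 1` and `i`, or `1` if these are not both less than `n`. -/
def adjacentSwap (i : ℕ) : Equiv.Perm (Fin n) :=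
  if h : i < n then Equiv.swap ⟨i - 1, by omega⟩ ⟨i, h⟩ else 1

variable {n} in
lemma adjacentSwap_eq {i : ℕ} (h : i < n) :
    adjacentSwap n i = Equiv.swap ⟨i - 1, by omega⟩ ⟨i, h⟩ := dif_pos h

/-- The standard primitive root of unity. -/
noncomputable def zeta (hm : 1 ≤ m) : rootsOfUnity m ℂ :=
  haveI : NeZero m := ⟨by omega⟩
  (Complex.isPrimitiveRoot_exp m (by omega)).toRootsOfUnity

/-- The reflection `diag(ζ, 1, …, 1)`, or `1` if `n = 0`. -/
noncomputable def tauElement (hm : 1 ≤ m) : reflectionGroup m n :=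
  diagonal fun i => if (i : ℕ) = 0 then zeta m hm else 1

/-- The m powers of ζ are distinct and therefore exhaust the m-th roots of unity. -/
lemma prod_X_sub_C_pow {F : Type*} [Field F] {m : ℕ} (hm : 1 ≤ m) {ζ : F}
    (h : IsPrimitiveRoot ζ m) :
    ∏ j : Fin m, (Polynomial.X - Polynomial.C (ζ ^ (j : ℕ))) = Polynomial.X ^ m - 1 := by
  rw [Polynomial.X_pow_sub_one_eq_prod (by omega) h]
  have hinj : Function.Injective fun j : Fin m => ζ ^ (j : ℕ) :=
    fun i j hij => Fin.ext (h.pow_inj i.2 j.2 hij)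
  have : Polynomial.nthRootsFinset m (1 : F) = Finset.univ.map ⟨_, hinj⟩ := by
    symm
    refine Finset.eq_of_subset_of_card_le ?_ ?_
    · intro x hx
      obtain ⟨j, _, rfl⟩ := Finset.mem_map.1 hx
      rw [Polynomial.mem_nthRootsFinset (by omega)]
      change (ζ ^ (j : ℕ)) ^ m = 1
      rw [← pow_mul, mul_comm, pow_mul, h.pow_eq_one, one_pow]
    · rw [h.card_nthRootsFinset]; simp
  rw [this, Finset.prod_map]
  rfl

/-- The generators of the reflection group satisfy the relations with `q = 1` and
`v_j = ζ^(j-1)`. -/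
theorem heckeSystem_reflectionGroup (hm : 1 ≤ m) :
    HeckeSystem (0 : ℂ) (fun j : Fin m => Complex.exp (2 * Real.pi * Complex.I / m) ^ (j : ℕ)) n
      (MonoidAlgebra.of ℂ (reflectionGroup m n) (tauElement m n hm))
      (fun i => MonoidAlgebra.of ℂ (reflectionGroup m n) (permutation (adjacentSwap n i))) where
  braid i h₁ h₂ := by
    simp only [← map_mul]
    congr 2
    rw [adjacentSwap_eq (show i < n by omega), adjacentSwap_eq (show i + 1 < n by omega)]
    ext x
    simp only [Equiv.Perm.mul_apply, Equiv.swap_apply_def, Fin.ext_iff, Nat.add_sub_cancel]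
    grind
  comm i j h₁ hij h₂ := by
    rw [commute_iff_eq]
    simp only [← map_mul]
    congr 2
    rw [adjacentSwap_eq (show i < n by omega), adjacentSwap_eq (show j < n by omega)]
    ext x
    simp only [Equiv.Perm.mul_apply, Equiv.swap_apply_def, Fin.ext_iff]
    grind
  tau_braid h := by
    simp only [← map_mul]
    congr 1
    -- Conjugating diag(ζ, 1, …, 1) by the first transposition gives diag(1, ζ, 1, …, 1). The
    -- relation then says that two diagonal matrices commute.
    have e : permutation (adjacentSwap n 1) * tauElement m n hm * permutation (adjacentSwap n 1) =
        diagonal fun i => if (i : ℕ) = 1 then zeta m hm else 1 := by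
      rw [tauElement, permutation_mul_diagonal, mul_assoc, ← map_mul, adjacentSwap_eq h,
        Equiv.swap_mul_self, map_one, mul_one, Equiv.swap_inv]
      congr 1
      funext i
      simp only [Equiv.swap_apply_def, Fin.ext_iff]
      grind
    rw [mul_assoc, mul_assoc, ← mul_assoc (permutation _) (tauElement m n hm), e, tauElement,
      ← map_mul, ← map_mul, mul_comm]
  tau_comm i h₁ h₂ := by
    rw [commute_iff_eq]
    simp only [← map_mul]
    congr 1
    rw [tauElement, permutation_mul_diagonal, adjacentSwap_eq (show i < n by omega),
      Equiv.swap_inv]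
    congr 2
    funext j
    simp only [Equiv.swap_apply_def, Fin.ext_iff]
    grind
  quadratic i h₁ h₂ := by
    rw [← map_mul, ← map_mul, adjacentSwap_eq (show i < n by omega), Equiv.swap_mul_self,
      map_one, map_one, zero_smul, zero_add]
  cyclotomic h := by
    have hζ := Complex.isPrimitiveRoot_exp m (by omega)
    have hp := congrArg (Polynomial.aeval
      (MonoidAlgebra.of ℂ (reflectionGroup m n) (tauElement m n hm))) (prod_X_sub_C_pow hm hζ)
    rw [← List.prod_ofFn, map_list_prod, List.map_ofFn] at hp
    simp only [Function.comp_def, map_sub, Polynomial.aeval_X, Polynomial.aeval_C, map_pow,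
      map_one] at hp
    simp only [map_pow]
    rw [hp, ← map_pow, tauElement, ← map_pow]
    have : (fun i : Fin n => if (i : ℕ) = 0 then zeta m hm else 1) ^ m = 1 := by
      funext i
      have : zeta m hm ^ m = 1 := Subtype.ext (zeta m hm).2
      simp only [Pi.pow_apply, Pi.one_apply]
      split_ifs <;> simp [this]
    rw [this, map_one, map_one, sub_self]

/-- The group algebra is generated by the images of the generators. -/
lemma subalgebra_eq_top (hm : 1 ≤ m) {B : Subalgebra ℂ (MonoidAlgebra ℂ (reflectionGroup m n))}
    (ht : 1 ≤ n → MonoidAlgebra.of ℂ (reflectionGroup m n) (tauElement m n hm) ∈ B)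
    (hs : ∀ i, 1 ≤ i → i + 1 ≤ n →
      MonoidAlgebra.of ℂ (reflectionGroup m n) (permutation (adjacentSwap n i)) ∈ B) : B = ⊤ := by
  have hΓ : B.toSubmonoid.comap (MonoidAlgebra.of ℂ (reflectionGroup m n)) = ⊤ := by
    rcases n with _ | n
    · refine eq_top_iff.2 fun g _ => ?_
      obtain ⟨⟨z, π⟩, rfl⟩ := monomial_bijective.surjective g
      change monomial z π ∈ _
      rw [Subsingleton.elim z 1, Subsingleton.elim π 1, monomial_one]
      exact one_mem _
    · refine eq_top_of_mem (fun i => ?_) fun z => ?_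
      · have := hs (i + 1) (by omega) (by omega)
        rw [adjacentSwap_eq (show (i : ℕ) + 1 < n + 1 by omega)] at this
        exact this
      · have : NeZero m := ⟨by omega⟩
        have hz : (((z : ℂˣ) : ℂ)) ^ m = 1 := by
          rw [← Units.val_pow_eq_pow_val, (mem_rootsOfUnity m _).1 z.2, Units.val_one]
        obtain ⟨k, _, hk⟩ :=
          (Complex.isPrimitiveRoot_exp m (by omega)).eq_pow_of_pow_eq_one hz
        -- Every m-th root of unity is a power of ζ, so diag(z, 1, …, 1) is a power of τ.
        have e : diagonal (Pi.mulSingle 0 z) = tauElement m (n + 1) hm ^ k := by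
          rw [tauElement, ← map_pow]
          congr 1
          funext i
          have hzk : z = zeta m hm ^ k := Subtype.ext (Units.ext hk.symm)
          simp only [Pi.mulSingle_apply, Pi.pow_apply, Fin.ext_iff, Fin.val_zero, hzk]
          split_ifs <;> simp
        rw [e]
        exact pow_mem (show tauElement m (n + 1) hm ∈ _ from ht (by omega)) k
  refine eq_top_iff.2 fun x _ => ?_
  clear * - hΓ
  induction x using MonoidAlgebra.induction_on with
  | of g =>
    have : g ∈ B.toSubmonoid.comap (MonoidAlgebra.of ℂ (reflectionGroup m n)) := by
      rw [hΓ]; trivial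
    exact this
  | add x y hx hy => exact add_mem hx hy
  | smul r x hx => exact Subalgebra.smul_mem _ hx r

end reflectionGroup

/-! ### The generic algebra, its specialization and the subalgebra W̃ -/

namespace CyclotomicHecke

lemma specialization_X (m : ℕ) (j : Fin m) : specialization m (MvPolynomial.X j) =
    Complex.exp (2 * Real.pi * Complex.I / m) ^ (j : ℕ) :=
  MvPolynomial.eval₂Hom_X' _ _ _

lemma specialization_genericQ (m : ℕ) :
    specialization m ((genericQ m : GenericRing m) - ((genericQ m)⁻¹ : (GenericRing m)ˣ)) = 0 := by
  have h : specialization m (genericQ m : GenericRing m) = 1 := by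
    change specialization m (MvPolynomial.C (LaurentPolynomial.T 1)) = 1
    rw [specialization, MvPolynomial.eval₂Hom_C, LaurentPolynomial.eval₂_T]
    simp
  have h' : specialization m ((genericQ m)⁻¹ : (GenericRing m)ˣ) = 1 := by
    have := congrArg (specialization m) (genericQ m).mul_inv
    rwa [map_mul, h, one_mul, map_one] at this
  rw [map_sub, h, h', sub_self]

/-- Together with `specialization_genericQ`, this makes the specialization to the group algebra an
admissible test point for the independence of the standard monomials. -/
lemma specialization_X_injective {m : ℕ} (hm : 1 ≤ m) :
    Function.Injective (specialization m ∘ (MvPolynomial.X : Fin m → GenericRing m)) := by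
  intro i j hij
  simp only [Function.comp, specialization_X] at hij
  exact Fin.ext ((Complex.isPrimitiveRoot_exp m (by omega)).pow_inj i.2 j.2 hij)

/-- The standard basis of the generic algebra. -/
noncomputable def genericBasis {m : ℕ} (hm : 1 ≤ m) (n : ℕ) :
    Module.Basis (MonomialIndex m n) (GenericRing m) (Generic m n) :=
  standardBasis (genericQ m) MvPolynomial.X n (specialization m) hm (specialization_genericQ m)
    (specialization_X_injective hm)

lemma finrank_generic {m : ℕ} (hm : 1 ≤ m) (n : ℕ) :
    Module.finrank (GenericRing m) (Generic m n) = n.factorial * m ^ n := by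
  rw [Module.finrank_eq_card_basis (genericBasis hm n), card_monomialIndex]

/-- The specialization of the generic algebra is the group algebra of the reflection group. -/
theorem nonempty_specialization_algEquiv {m : ℕ} (hm : 1 ≤ m) (n : ℕ) :
    letI : Algebra (GenericRing m) ℂ := specializationAlgebra m
    Nonempty (ℂ ⊗[GenericRing m] Generic m n ≃ₐ[ℂ] MonoidAlgebra ℂ (reflectionGroup m n)) := by
  let _ : Algebra (GenericRing m) ℂ := specializationAlgebra m
  have hsys : HeckeSystem ((genericQ m : GenericRing m) - ((genericQ m)⁻¹ : (GenericRing m)ˣ))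
      (MvPolynomial.X : Fin m → GenericRing m) n
      (MonoidAlgebra.of ℂ (reflectionGroup m n) (reflectionGroup.tauElement m n hm))
      (fun i => MonoidAlgebra.of ℂ (reflectionGroup m n)
        (reflectionGroup.permutation (reflectionGroup.adjacentSwap n i))) := by
    refine HeckeSystem.of_algebraMap (F := ℂ) ?_
    have h0 : algebraMap (GenericRing m) ℂ
      ((genericQ m : GenericRing m) - ((genericQ m)⁻¹ : (GenericRing m)ˣ)) = 0 :=
        specialization_genericQ m
    have hX : (fun j : Fin m => algebraMap (GenericRing m) ℂ (MvPolynomial.X j)) =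
        fun j : Fin m => Complex.exp (2 * Real.pi * Complex.I / m) ^ (j : ℕ) :=
      funext (specialization_X m)
    rw [h0, hX]
    exact reflectionGroup.heckeSystem_reflectionGroup m n hm
  let f : ℂ ⊗[GenericRing m] Generic m n →ₐ[ℂ] MonoidAlgebra ℂ (reflectionGroup m n) :=
    Algebra.TensorProduct.lift (Algebra.ofId ℂ _) (liftHom hsys)
      fun r x => Algebra.commutes r _
  have hf : ∀ x : Generic m n, f (1 ⊗ₜ x) = liftHom hsys x := fun x =>
    (Algebra.TensorProduct.lift_tmul _ _ _ _ _).trans (by rw [map_one, one_mul])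
  have hsurj : Function.Surjective f := by
    rw [← AlgHom.range_eq_top]
    refine reflectionGroup.subalgebra_eq_top m n hm (fun h => ?_) fun i h₁ h₂ => ?_
    · exact ⟨1 ⊗ₜ tau _ _ n h, (hf _).trans (liftHom_tau hsys h)⟩
    · exact ⟨1 ⊗ₜ sigma _ _ n i h₁ h₂, (hf _).trans (liftHom_sigma hsys i h₁ h₂)⟩
  have hfree : Module.Free (GenericRing m) (Generic m n) := .of_basis (genericBasis hm n)
  have hfin : Module.Finite (GenericRing m) (Generic m n) := .of_basis (genericBasis hm n)
  have hcard : Nat.card (reflectionGroup m n) = n.factorial * m ^ n := reflectionGroup.card_eq hm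
  have : Finite (reflectionGroup m n) := Nat.finite_of_card_ne_zero (by
    rw [hcard]
    exact Nat.mul_ne_zero (Nat.factorial_ne_zero n) (pow_ne_zero _ (by omega)))
  have hG : Module.Finite ℂ (MonoidAlgebra ℂ (reflectionGroup m n)) :=
    .of_basis (MonoidAlgebra.basis _ ℂ)
  -- Base change preserves the rank of a free module, so the surjection `f` is between spaces of the
  -- same dimension n! m^n and hence injective.
  have hrank : Module.finrank ℂ (ℂ ⊗[GenericRing m] Generic m n) =
      Module.finrank ℂ (MonoidAlgebra ℂ (reflectionGroup m n)) := by
    rw [Module.finrank_baseChange, finrank_generic hm,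
      Module.finrank_eq_nat_card_basis (MonoidAlgebra.basis (reflectionGroup m n) ℂ), hcard]
  have hinj : Function.Injective f :=
    (LinearMap.injective_iff_surjective_of_finrank_eq_finrank (f := f.toLinearMap) hrank).2 hsurj
  exact ⟨AlgEquiv.ofBijective f ⟨hinj, hsurj⟩⟩

/-- The subalgebra generated by all generators but the last is the algebra of level `n - 1`. -/
theorem exists_algEquiv_subW {m n : ℕ} (hm : 1 ≤ m) (hn : 1 ≤ n) :
    ∃ e : Generic m (n - 1) ≃ₐ[GenericRing m]
        subW (genericQ m) (MvPolynomial.X : Fin m → GenericRing m) n,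
      (∀ h : 1 ≤ n - 1,
        (e (tau _ _ (n - 1) h) : Generic m n) = tau _ _ n (by omega)) ∧
      ∀ (i : ℕ) (h₁ : 1 ≤ i) (h₂ : i + 1 ≤ n - 1),
        (e (sigma _ _ (n - 1) i h₁ h₂) : Generic m n) = sigma _ _ n i h₁ (by omega) := by
  obtain ⟨n, rfl⟩ : ∃ k, n = k + 1 := ⟨n - 1, by omega⟩
  have hinj := inclusionHom_injective (genericQ m) MvPolynomial.X n (specialization m) hm
    (specialization_genericQ m) (specialization_X_injective hm)
  refine ⟨(AlgEquiv.ofInjective _ hinj).trans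
    (Subalgebra.equivOfEq _ _ (inclusionHom_range _ _ (n + 1))), ?_, ?_⟩
  · exact fun h => inclusionHom_tau _ _ (n + 1) h
  · exact fun i h₁ h₂ => inclusionHom_sigma _ _ (n + 1) i h₁ h₂

end CyclotomicHecke

open CyclotomicHecke in
theorem mainTheorem2 (m n : ℕ) (hm : 1 ≤ m) :
    -- (i) freeness over `ℂ[q, q⁻¹, v_1, …, v_m]` and the rank
    (Module.Free (GenericRing m) (Generic m n) ∧
      Module.Finite (GenericRing m) (Generic m n) ∧
      Module.finrank (GenericRing m) (Generic m n) = Nat.card (reflectionGroup m n) ∧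
      Nat.card (reflectionGroup m n) = n.factorial * m ^ n) ∧
    -- (i) the specialization at `q = 1`, `v_j = ζ^{j-1}` is the group algebra of `G(m,1,n)`
    (letI : Algebra (GenericRing m) ℂ := specializationAlgebra m
     Nonempty (ℂ ⊗[GenericRing m] Generic m n ≃ₐ[ℂ] MonoidAlgebra ℂ (reflectionGroup m n))) ∧
    -- (ii) `H(m,1,n-1)` is isomorphic to the subalgebra `W̃`, generators going to generators
    (1 ≤ n →
      ∃ e : Generic m (n - 1) ≃ₐ[GenericRing m]
          subW (genericQ m) (MvPolynomial.X : Fin m → GenericRing m) n,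
        (∀ h : 1 ≤ n - 1,
          (e (tau _ _ (n - 1) h) : Generic m n) = tau _ _ n (by omega)) ∧
        ∀ (i : ℕ) (h₁ : 1 ≤ i) (h₂ : i + 1 ≤ n - 1),
          (e (sigma _ _ (n - 1) i h₁ h₂) : Generic m n) = sigma _ _ n i h₁ (by omega)) :=
  ⟨⟨.of_basis (genericBasis hm n), .of_basis (genericBasis hm n),
      (finrank_generic hm n).trans (reflectionGroup.card_eq hm).symm, reflectionGroup.card_eq hm⟩,
    nonempty_specialization_algEquiv hm n, exists_algEquiv_subW hm⟩
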